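/- **Proposition 3.1.** Consider the symmetric planar Purcell swimmer: three slender rigid links of lengths $l_0>0$ (centre) and $l_1=l_2>0$ (outer), with $l=l_0+l_1+l_2$ and $\eta=l_0/l$. Let $q=(x,y,\theta)$ be the position of the centre and the orientation of the centre link. With $\mathbf t(\alpha)=(\cos\alpha,\sin\alpha)$ and $\mathbf n(\alpha)=(-\sin\alpha,\cos\alpha)$, the joints are at $\mathbf b_1=(x,y)-\frac{l_0}{2}\mathbf t(\theta)$ and $\mathbf b_2=(x,y)+\frac{l_0}{2}\mathbf t(\theta)$. For joint angles $\phi_1,\phi_2$, the outer links have orientations $\alpha_1=\theta-\phi_1$, $\alpha_2=\theta+\phi_2$ and centres $\mathbf r_1=\mathbf b_1-\frac{l_1}{2}\mathbf t(\alpha_1)$, $\mathbf r_2=\mathbf b_2+\frac{l_2}{2}\mathbf t(\alpha_2)$; for the centre link put $\alpha_0=\theta$, $\mathbf r_0=(x,y)$. By resistive force theory, with a constant $c_t>0$ and $c_n=2c_t$, the $i$-th link, moving with centre velocity $\mathbf v_i=\dot{\mathbf r}_i$ and angular velocity $\omega_i=\dot\alpha_i$, feels the drag force $\mathbf f_i=-c_tl_i(\mathbf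 v_i\cdot\mathbf t(\alpha_i))\mathbf t(\alpha_i)-c_nl_i(\mathbf v_i\cdot\mathbf n(\alpha_i))\mathbf n(\alpha_i)$ and the drag torque $m_i=-\frac1{12}c_nl_i^3\omega_i$. The total force and the total torque on the swimmer vanish; this determines $\dot q=\mathcal G(q,\phi)\,\dot\phi$. For a gait $s=(s_1,s_2)$ on $[0,T]$ and an amplitude $\varepsilon\in\mathbb R$, prescribe $\phi(t)=\varepsilon s(t)$, and let $q$ be continuous on $[0,T]$ with $\theta(0)=0$ and satisfy the equation of motion at all but finitely many times. For each of the two gaits below such a motion exists for every $\varepsilon$, and the net displacement over one stroke, $X=\int_0^T\dot x\,dt=x(T)-x(0)$, depends only on $\varepsilon$ (for the given swimmer and gait). For fixed lengths, as $\varepsilon\to0$, $$X=f_2(\eta)\,\varepsilon^2-f_4(\eta)\,\varepsilon^4+O(\varepsilon^6),$$ $$f_2(\eta)=C_2\,\eta\, l\,(1-\eta)^3(\eta+3),$$ $$f_4(\eta)=C_4\,\eta\, l\,(1-\eta)^3\left(\eta^7+3\eta^6-10\eta^5-22\eta^4+29\eta^3+95\eta^2+44\eta+20\right).$$ * Square gait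 ($T=8$): $s(t)=(1,1-t)$ on $[0,2]$, $(3-t,-1)$ on $[2,4]$, $(-1,t-5)$ on $[4,6]$, $(t-7,1)$ on $[6,8]$. Then $C_2=\frac14$ and $C_4=\frac1{192}$. * Circular gait ($T=2\pi$): $s(t)=\left(\sin(t+\frac\pi4),\cos(t+\frac\pi4)\right)$. Then $C_2=\frac{\pi}{16}$ and $C_4=\frac{\pi}{1024}$. -/

import Mathlib

open Set Filter Topology Asymptotics

noncomputable section

namespace PurcellSwimmer

/-- Absolute orientation angles `α₀, α₁, α₂` of the three links, when the centre link has
orientation `θ` and the joint angles are `φ = (φ₁, φ₂)` (here `φ 0, φ 1`).  Link `1` hangs on the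
rear (`-x`) end of the centre link and link `2` on its front (`+x`) end; positive joint angles
bend both outer links to the same side of the centre link. -/
def linkAngle (θ : ℝ) (φ : Fin 2 → ℝ) : Fin 3 → ℝ :=
  ![θ, θ - φ 0, θ + φ 1]

/-- Unit vector in the axial direction of a link with orientation `α`. -/
def axial (α : ℝ) : Fin 2 → ℝ := ![Real.cos α, Real.sin α]

/-- Positions `b_j - r_0` of the two joints relative to the centre of the centre link;
`L i` is the length of link `i`. -/
def jointPos (L : Fin 3 → ℝ) (θ : ℝ) : Fin 2 → Fin 2 → ℝ :=
  ![-(L 0 / 2) • axial θ, (L 0 / 2) • axial θ]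

/-- Positions `r_i - r_0` of the centres of the links relative to the centre of the centre
link. -/
def linkPos (L : Fin 3 → ℝ) (θ : ℝ) (φ : Fin 2 → ℝ) : Fin 3 → Fin 2 → ℝ :=
  ![0,
    jointPos L θ 0 - (L 1 / 2) • axial (linkAngle θ φ 1),
    jointPos L θ 1 + (L 2 / 2) • axial (linkAngle θ φ 2)]

/-- The indicator matrix: `indicator i j = ∂α_i / ∂φ_j` is `±1` if joint `j` moves link `i`
relative to the centre link, and `0` otherwise. -/
def indicator : Matrix (Fin 3) (Fin 2) ℝ := !![0, 0; -1, 0; 0, 1]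

/-- The matrix `T_i`: rigid motion `(v_b, ω_b)` of the body gives link `i` the velocity
`v_i = v_b + ω_b z × (r_i - r_0)`, `ω_i = ω_b`. -/
def bodyJac (L : Fin 3 → ℝ) (θ : ℝ) (φ : Fin 2 → ℝ) (i : Fin 3) : Matrix (Fin 3) (Fin 3) ℝ :=
  !![1, 0, -linkPos L θ φ i 1;
     0, 1, linkPos L θ φ i 0;
     0, 0, 1]

/-- The matrix `E_i`: joint velocities `φ'` give link `i` the velocity
`v_i = ∑ j, I_ij φ'_j z × (r_i - b_j)`, `ω_i = ∑ j, I_ij φ'_j`. -/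
def shapeJac (L : Fin 3 → ℝ) (θ : ℝ) (φ : Fin 2 → ℝ) (i : Fin 3) : Matrix (Fin 3) (Fin 2) ℝ :=
  Matrix.of fun k j =>
    indicator i j *
      ![-(linkPos L θ φ i 1 - jointPos L θ j 1), linkPos L θ φ i 0 - jointPos L θ j 0, 1] k

/-- Resistance tensor of a slender link of length `len` and orientation `α` in resistive force
theory, with axial coefficient `ct` and normal coefficient `cn = 2 * ct`: the drag is
`f = - ct len (v·t) t - cn len (v·n) n` and the drag torque is `m = - (1/12) cn len³ ω`. -/
def resistance (ct len α : ℝ) : Matrix (Fin 3) (Fin 3) ℝ :=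
  (ct * len) •
    !![1 + Real.sin α ^ 2, -(Real.cos α * Real.sin α), 0;
       -(Real.cos α * Real.sin α), 1 + Real.cos α ^ 2, 0;
       0, 0, len ^ 2 / 6]

/-- `R_bb = ∑ i, T_iᵀ R_i T_i`. -/
def Rbb (ct : ℝ) (L : Fin 3 → ℝ) (θ : ℝ) (φ : Fin 2 → ℝ) : Matrix (Fin 3) (Fin 3) ℝ :=
  ∑ i, (bodyJac L θ φ i).transpose * resistance ct (L i) (linkAngle θ φ i) * bodyJac L θ φ i

/-- `R_bu = ∑ i, T_iᵀ R_i E_i`. -/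
def Rbu (ct : ℝ) (L : Fin 3 → ℝ) (θ : ℝ) (φ : Fin 2 → ℝ) : Matrix (Fin 3) (Fin 2) ℝ :=
  ∑ i, (bodyJac L θ φ i).transpose * resistance ct (L i) (linkAngle θ φ i) * shapeJac L θ φ i

/-- `𝒢(q, φ) = - R_bb⁻¹ R_bu`, where `q = (x, y, θ)`: the total drag force and torque
`-(R_bb q' + R_bu φ')` on the swimmer vanish iff `q' = 𝒢(q, φ) φ'`. -/
def dynMatrix (ct : ℝ) (L : Fin 3 → ℝ) (q : Fin 3 → ℝ) (φ : Fin 2 → ℝ) :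
    Matrix (Fin 3) (Fin 2) ℝ :=
  -((Rbb ct L (q 2) φ)⁻¹ * Rbu ct L (q 2) φ)

/-- The inverse in `dynMatrix` is a true inverse whenever the links have positive lengths. -/
theorem isUnit_det_Rbb {ct : ℝ} {L : Fin 3 → ℝ} (hct : 0 < ct) (hL : ∀ i, 0 < L i)
    (θ : ℝ) (φ : Fin 2 → ℝ) : IsUnit (Rbb ct L θ φ).det := by
  have key : ∀ (i : Fin 3) (w : Fin 3 → ℝ),
      w ⬝ᵥ ((resistance ct (L i) (linkAngle θ φ i)).mulVec w)
        = ct * L i * (w 0 ^ 2 + w 1 ^ 2 + (Real.sin (linkAngle θ φ i) * w 0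
            - Real.cos (linkAngle θ φ i) * w 1) ^ 2 + L i ^ 2 / 6 * w 2 ^ 2) := by
    intro i w
    simp [resistance, Matrix.mulVec, dotProduct, Fin.sum_univ_three]
    ring
  have hform : ∀ v : Fin 3 → ℝ, v ⬝ᵥ ((Rbb ct L θ φ).mulVec v)
      = ∑ i, (bodyJac L θ φ i).mulVec v ⬝ᵥ
          ((resistance ct (L i) (linkAngle θ φ i)).mulVec ((bodyJac L θ φ i).mulVec v)) := by
    intro v
    rw [Rbb, Matrix.sum_mulVec, dotProduct_sum]
    refine Finset.sum_congr rfl fun i _ => ?_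
    rw [← Matrix.mulVec_mulVec, ← Matrix.mulVec_mulVec, Matrix.dotProduct_mulVec,
      Matrix.vecMul_transpose]
  rw [isUnit_iff_ne_zero]
  intro hdet
  obtain ⟨v, hv, hv0⟩ := Matrix.exists_mulVec_eq_zero_iff.mpr hdet
  have h0 := hform v
  rw [hv0, dotProduct_zero] at h0
  have hnn : ∀ i ∈ Finset.univ, 0 ≤ (bodyJac L θ φ i).mulVec v ⬝ᵥ
      ((resistance ct (L i) (linkAngle θ φ i)).mulVec ((bodyJac L θ φ i).mulVec v)) := by
    intro i _
    rw [key]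
    have := hL i
    positivity
  have h1 := (Finset.sum_eq_zero_iff_of_nonneg hnn).mp h0.symm 0 (Finset.mem_univ _)
  have hT : (bodyJac L θ φ 0).mulVec v = v := by
    ext k
    fin_cases k <;> simp [bodyJac, linkPos, Matrix.mulVec, dotProduct, Fin.sum_univ_three]
  rw [hT, key] at h1
  have hL0 := hL 0
  have h2 := (mul_eq_zero.mp h1).resolve_left (by positivity)
  have a0 : 0 ≤ L 0 ^ 2 / 6 * v 2 ^ 2 := by positivity
  have a1 := sq_nonneg (Real.sin (linkAngle θ φ 0) * v 0 - Real.cos (linkAngle θ φ 0) * v 1)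
  have e0 : v 0 = 0 := by
    have : v 0 ^ 2 = 0 := by nlinarith [sq_nonneg (v 0), sq_nonneg (v 1)]
    simpa using this
  have e1 : v 1 = 0 := by
    have : v 1 ^ 2 = 0 := by nlinarith [sq_nonneg (v 0), sq_nonneg (v 1)]
    simpa using this
  have e2 : v 2 = 0 := by
    have : L 0 ^ 2 / 6 * v 2 ^ 2 = 0 := by nlinarith [sq_nonneg (v 0), sq_nonneg (v 1)]
    have := (mul_eq_zero.mp this).resolve_left (by positivity)
    simpa using this
  apply hv
  ext k
  fin_cases k <;> simp [e0, e1, e2]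

/-- `q = (x, y, θ)` is the motion of the swimmer on `[0, T]` under the shape input `φ`, with
initial orientation `θ(0) = 0`: it is continuous and satisfies `q' = 𝒢(q, φ) φ'` at all but
finitely many times (the shape velocity of a piecewise smooth gait jumps at its corners). -/
structure IsMotion (ct : ℝ) (L : Fin 3 → ℝ) (φ : ℝ → Fin 2 → ℝ) (T : ℝ)
    (q : ℝ → Fin 3 → ℝ) : Prop where
  continuousOn : ContinuousOn q (Icc 0 T)
  orientation_zero : q 0 2 = 0
  dynamics : ∃ N : Set ℝ, N.Finite ∧ ∀ t ∈ Ioo 0 T \ N, ∃ dφ : Fin 2 → ℝ,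
    HasDerivAt φ dφ t ∧ HasDerivAt q ((dynMatrix ct L (q t) (φ t)).mulVec dφ) t

/-- The swimmer with shape input `φ` on `[0, T]` has the net `x`-displacement `X`: a motion
exists, and along every motion `x(T) - x(0) = X`. -/
def HasNetDisplacement (ct : ℝ) (L : Fin 3 → ℝ) (φ : ℝ → Fin 2 → ℝ) (T X : ℝ) : Prop :=
  (∃ q, IsMotion ct L φ T q) ∧ ∀ q, IsMotion ct L φ T q → q T 0 - q 0 0 = X

/-- The unscaled square gait, of period `8` (only its values on `[0, 8]` matter). -/
def squareGait (t : ℝ) : Fin 2 → ℝ :=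
  if t ≤ 2 then ![1, 1 - t]
  else if t ≤ 4 then ![3 - t, -1]
  else if t ≤ 6 then ![-1, t - 5]
  else ![t - 7, 1]

/-- The unscaled circular gait, of period `2π`. -/
def circularGait (t : ℝ) : Fin 2 → ℝ :=
  ![Real.sin (t + Real.pi / 4), Real.cos (t + Real.pi / 4)]

/-- The coefficient of `ε²`. -/
def f2 (C2 l η : ℝ) : ℝ := C2 * η * l * (1 - η) ^ 3 * (η + 3)

/-- Minus the coefficient of `ε⁴`. -/
def f4 (C4 l η : ℝ) : ℝ :=
  C4 * η * l * (1 - η) ^ 3 *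
    (η ^ 7 + 3 * η ^ 6 - 10 * η ^ 5 - 22 * η ^ 4 + 29 * η ^ 3 + 95 * η ^ 2 + 44 * η + 20)

end PurcellSwimmer

end

/-!
The equations of motion do not depend on the position, and they depend on the orientation `θ` only
through a rotation (`dynMatrix_eq_rotation`).  Hence `θ(t)` is the integral along the shape path of
a one-form in the joint angles, and then the net displacement is the integral of
`cos θ · g - sin θ · k`, where the one-forms `g`, `k` give the body velocity.  This gives existence
and uniqueness without any theory of differential equations (`IsShapePath.hasNetDisplacement`).

The body velocities solve a `3 × 3` linear system, which at the straight shape is diagonal.  Their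
Taylor polynomials are verified by inserting them into the system: a residual of high order and a
bootstrap argument bound the error (`isBigO_sub_of_perturbed_system`,
`hasVelocityExpansion_dynMatrix`).  Under the reflection `φ ↦ -φ` the component `v_x` is odd in `φ`
and `v_y`, `ω` are even, so that only even powers of the amplitude appear in the displacement up to
the error `O(ε⁶)`.

Inserting the Taylor polynomials, with all errors uniform in time, expresses the coefficients of
`ε²` and `ε⁴` as integrals of explicit one-forms along the gait (`isBigO_displacement`).  Removing
exact forms, which do not contribute along a closed path, reduces them to the moments `∮ v du`,
`∮ u² v du`, `∮ u v² du` and `∮ v³ du` (`integral_form2`, `integral_form4`).  For both gaits the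
third of these vanishes and the last one is three times the second, so that the two expansions have
the same polynomials in `η` and differ only in the values of `∮ v du` and `∮ u² v du`.
-/

namespace PurcellSwimmer

/-! ### Rotation equivariance and continuity of the dynamics -/

/-- Rotation by the angle `θ`, acting on planar velocities `(v_x, v_y, ω)`. -/
noncomputable def rotation (θ : ℝ) : Matrix (Fin 3) (Fin 3) ℝ :=
  !![Real.cos θ, -Real.sin θ, 0;
     Real.sin θ, Real.cos θ, 0;
     0, 0, 1]

theorem rotation_mul_transpose (θ : ℝ) : rotation θ * (rotation θ).transpose = 1 := by
  have h := Real.sin_sq_add_cos_sq θ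
  ext i j
  fin_cases i <;> fin_cases j <;>
    simp [rotation, Matrix.mul_apply, Fin.sum_univ_three] <;> linarith

theorem transpose_mul_rotation (θ : ℝ) : (rotation θ).transpose * rotation θ = 1 :=
  mul_eq_one_comm.mp (rotation_mul_transpose θ)

theorem bodyJac_eq_rotation (L : Fin 3 → ℝ) (θ : ℝ) (φ : Fin 2 → ℝ) (i : Fin 3) :
    bodyJac L θ φ i = rotation θ * bodyJac L 0 φ i * (rotation θ).transpose := by
  have h := Real.sin_sq_add_cos_sq θ
  ext k j
  fin_cases i <;> fin_cases k <;> fin_cases j <;>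
    simp [bodyJac, rotation, linkPos, jointPos, linkAngle, axial, Matrix.mul_apply,
      Fin.sum_univ_three, Real.sin_add, Real.cos_add, Real.sin_sub, Real.cos_sub] <;>
    linarith

theorem shapeJac_eq_rotation (L : Fin 3 → ℝ) (θ : ℝ) (φ : Fin 2 → ℝ) (i : Fin 3) :
    shapeJac L θ φ i = rotation θ * shapeJac L 0 φ i := by
  ext k j
  fin_cases i <;> fin_cases k <;> fin_cases j <;>
    simp [shapeJac, indicator, rotation, linkPos, jointPos, linkAngle, axial, Matrix.mul_apply,
      Fin.sum_univ_three, Real.sin_add, Real.cos_add, Real.sin_sub, Real.cos_sub] <;>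
    linarith

theorem resistance_add_eq_rotation (ct len θ α : ℝ) :
    resistance ct len (θ + α)
      = rotation θ * resistance ct len α * (rotation θ).transpose := by
  have h := Real.sin_sq_add_cos_sq θ
  have h' := Real.sin_sq_add_cos_sq α
  ext k j
  fin_cases k <;> fin_cases j <;>
    simp [resistance, rotation, Matrix.mul_apply, Fin.sum_univ_three, Real.sin_add,
      Real.cos_add] 
  · linear_combination (-ct * len) * h
  · linear_combination (0:ℝ) * h
  · linear_combination (0:ℝ) * h
  · linear_combination (-ct * len) * h

theorem linkAngle_eq_add (θ : ℝ) (φ : Fin 2 → ℝ) (i : Fin 3) :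
    linkAngle θ φ i = θ + linkAngle 0 φ i := by
  fin_cases i <;> simp [linkAngle, sub_eq_add_neg]

theorem Rbb_eq_rotation (ct : ℝ) (L : Fin 3 → ℝ) (θ : ℝ) (φ : Fin 2 → ℝ) :
    Rbb ct L θ φ = rotation θ * Rbb ct L 0 φ * (rotation θ).transpose := by
  simp only [Rbb, Matrix.mul_sum, Matrix.sum_mul]
  refine Finset.sum_congr rfl fun i _ => ?_
  rw [bodyJac_eq_rotation, linkAngle_eq_add, resistance_add_eq_rotation]
  simp only [Matrix.transpose_mul, Matrix.transpose_transpose, Matrix.mul_assoc]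
  simp only [← Matrix.mul_assoc (rotation θ).transpose (rotation θ), transpose_mul_rotation,
    Matrix.one_mul]

theorem Rbu_eq_rotation (ct : ℝ) (L : Fin 3 → ℝ) (θ : ℝ) (φ : Fin 2 → ℝ) :
    Rbu ct L θ φ = rotation θ * Rbu ct L 0 φ := by
  simp only [Rbu, Matrix.mul_sum]
  refine Finset.sum_congr rfl fun i _ => ?_
  rw [bodyJac_eq_rotation, linkAngle_eq_add, resistance_add_eq_rotation, shapeJac_eq_rotation]
  simp only [Matrix.transpose_mul, Matrix.transpose_transpose, Matrix.mul_assoc]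
  simp only [← Matrix.mul_assoc (rotation θ).transpose (rotation θ), transpose_mul_rotation,
    Matrix.one_mul]

/-- Resistive force theory is equivariant under rotations: the dynamics at orientation `θ` is the
rotated dynamics at orientation `0`. -/
theorem dynMatrix_eq_rotation (ct : ℝ) (L : Fin 3 → ℝ) (q : Fin 3 → ℝ) (φ : Fin 2 → ℝ) :
    dynMatrix ct L q φ = rotation (q 2) * dynMatrix ct L 0 φ := by
  have hinv : (rotation (q 2))⁻¹ = (rotation (q 2)).transpose :=
    Matrix.inv_eq_right_inv (rotation_mul_transpose _)
  have hinv' : ((rotation (q 2)).transpose)⁻¹ = rotation (q 2) :=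
    Matrix.inv_eq_right_inv (transpose_mul_rotation _)
  rw [dynMatrix, dynMatrix, Rbb_eq_rotation, Rbu_eq_rotation, Matrix.mul_inv_rev,
    Matrix.mul_inv_rev, hinv, hinv']
  simp only [Matrix.mul_neg, Matrix.mul_assoc, Pi.zero_apply]
  simp only [← Matrix.mul_assoc (rotation (q 2)).transpose (rotation (q 2)),
    transpose_mul_rotation, Matrix.one_mul]

theorem continuous_dynMatrix_zero {ct : ℝ} {L : Fin 3 → ℝ} (hct : 0 < ct) (hL : ∀ i, 0 < L i) :
    Continuous fun φ => dynMatrix ct L 0 φ := by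
  have hα : ∀ i, Continuous fun φ : Fin 2 → ℝ => linkAngle 0 φ i := by
    intro i
    fin_cases i <;> simp [linkAngle] <;> fun_prop
  have hpos : ∀ i k, Continuous fun φ : Fin 2 → ℝ => linkPos L 0 φ i k := by
    intro i k
    fin_cases i <;> fin_cases k <;> simp [linkPos, jointPos, linkAngle, axial] <;> fun_prop
  have hT : ∀ i, Continuous fun φ : Fin 2 → ℝ => bodyJac L 0 φ i := by
    intro i
    have := hpos i
    refine continuous_matrix fun k j => ?_
    fin_cases k <;> fin_cases j <;> simp [bodyJac] <;> fun_prop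
  have hE : ∀ i, Continuous fun φ : Fin 2 → ℝ => shapeJac L 0 φ i := by
    intro i
    have := hpos i
    refine continuous_matrix fun k j => ?_
    fin_cases k <;> simp [shapeJac] <;> fun_prop
  have hR : ∀ i, Continuous fun φ : Fin 2 → ℝ => resistance ct (L i) (linkAngle 0 φ i) := by
    intro i
    have := hα i
    refine continuous_matrix fun k j => ?_
    fin_cases k <;> fin_cases j <;> simp [resistance] <;> fun_prop
  have hbb : Continuous fun φ : Fin 2 → ℝ => Rbb ct L 0 φ :=
    continuous_finsetSum _ fun i _ =>
      (((hT i).matrix_transpose).matrix_mul (hR i)).matrix_mul (hT i)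
  have hbu : Continuous fun φ : Fin 2 → ℝ => Rbu ct L 0 φ :=
    continuous_finsetSum _ fun i _ =>
      (((hT i).matrix_transpose).matrix_mul (hR i)).matrix_mul (hE i)
  have hinv : Continuous fun φ : Fin 2 → ℝ => (Rbb ct L 0 φ)⁻¹ := by
    simp only [Matrix.inv_def, Ring.inverse_eq_inv']
    exact (hbb.matrix_det.inv₀ fun φ => (isUnit_det_Rbb hct hL 0 φ).ne_zero).smul
      hbb.matrix_adjugate
  exact (hinv.matrix_mul hbu).neg

/-! ### Motions along piecewise smooth shape paths -/

/-- A piecewise smooth shape path `φ` with velocity `D`: `φ` is continuous, the velocity is bounded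
and measurable, and off the finite set `N` it is continuous and is the derivative of `φ`. -/
structure IsShapePath (φ D : ℝ → Fin 2 → ℝ) (N : Set ℝ) : Prop where
  continuous : Continuous φ
  measurable : ∀ j, Measurable fun t => D t j
  bounded : ∃ M, ∀ t j, |D t j| ≤ M
  finite : N.Finite
  hasDerivAt : ∀ t ∉ N, HasDerivAt φ (D t) t
  continuousAt : ∀ t ∉ N, ContinuousAt D t

/-- The pullback to the time axis of the one-form `c₀ dφ₁ + c₁ dφ₂`, for time-dependent
coefficients `c₀, c₁`, along a shape path of velocity `D`. -/
def pullback (c D : ℝ → Fin 2 → ℝ) (t : ℝ) : ℝ := c t 0 * D t 0 + c t 1 * D t 1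

namespace IsShapePath

variable {φ D : ℝ → Fin 2 → ℝ} {N : Set ℝ}

theorem const_smul (h : IsShapePath φ D N) (ε : ℝ) :
    IsShapePath (fun t => ε • φ t) (fun t => ε • D t) N where
  continuous := h.continuous.const_smul ε
  measurable j := by simpa using (h.measurable j).const_mul ε
  bounded := by
    obtain ⟨M, hM⟩ := h.bounded
    refine ⟨|ε| * M, fun t j => ?_⟩
    simpa [abs_mul] using mul_le_mul_of_nonneg_left (hM t j) (abs_nonneg ε)
  finite := h.finite
  hasDerivAt t ht := (h.hasDerivAt t ht).const_smul ε
  continuousAt t ht := (h.continuousAt t ht).const_smul ε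

theorem continuous_apply (h : IsShapePath φ D N) (j : Fin 2) : Continuous fun t => φ t j :=
  (_root_.continuous_apply j).comp h.continuous

theorem hasDerivAt_apply (h : IsShapePath φ D N) {t : ℝ} (ht : t ∉ N) (j : Fin 2) :
    HasDerivAt (fun t => φ t j) (D t j) t :=
  hasDerivAt_pi.mp (h.hasDerivAt t ht) j

theorem intervalIntegrable_velocity (h : IsShapePath φ D N) (j : Fin 2) (a b : ℝ) :
    IntervalIntegrable (fun t => D t j) MeasureTheory.volume a b := by
  obtain ⟨M, hM⟩ := h.bounded
  refine (intervalIntegrable_const (c := M)).mono_fun (h.measurable j).aestronglyMeasurable ?_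
  filter_upwards with t
  simpa using (hM t j).trans (le_abs_self M)

theorem intervalIntegrable_pullback (h : IsShapePath φ D N) {c : ℝ → Fin 2 → ℝ}
    (hc : ∀ j, Continuous fun t => c t j) (a b : ℝ) :
    IntervalIntegrable (pullback c D) MeasureTheory.volume a b :=
  ((h.intervalIntegrable_velocity 0 a b).continuousOn_mul (hc 0).continuousOn).add
    ((h.intervalIntegrable_velocity 1 a b).continuousOn_mul (hc 1).continuousOn)

theorem continuous_integral_pullback (h : IsShapePath φ D N) {c : ℝ → Fin 2 → ℝ}
    (hc : ∀ j, Continuous fun t => c t j) :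
    Continuous fun t => ∫ τ in (0 : ℝ)..t, pullback c D τ :=
  intervalIntegral.continuous_primitive (h.intervalIntegrable_pullback hc) 0

theorem hasDerivAt_integral_pullback (h : IsShapePath φ D N) {c : ℝ → Fin 2 → ℝ}
    (hc : ∀ j, Continuous fun t => c t j) {t : ℝ} (ht : t ∉ N) :
    HasDerivAt (fun t => ∫ τ in (0 : ℝ)..t, pullback c D τ) (pullback c D t) t := by
  have hmeas : Measurable (pullback c D) :=
    ((hc 0).measurable.mul (h.measurable 0)).add ((hc 1).measurable.mul (h.measurable 1))
  have hD : ∀ j, ContinuousAt (fun t => D t j) t := fun j =>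
    (_root_.continuous_apply j).continuousAt.comp (h.continuousAt t ht)
  exact intervalIntegral.integral_hasDerivAt_right (h.intervalIntegrable_pullback hc 0 t)
    hmeas.stronglyMeasurable.stronglyMeasurableAtFilter
    (((hc 0).continuousAt.mul (hD 0)).add ((hc 1).continuousAt.mul (hD 1)))

/-- The fundamental theorem of calculus along a shape path. -/
theorem integral_pullback_eq_sub (h : IsShapePath φ D N) {c : ℝ → Fin 2 → ℝ}
    (hc : ∀ j, Continuous fun t => c t j) {f : ℝ → ℝ} {N' : Set ℝ} (hN' : N'.Finite) {b : ℝ}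
    (hb : 0 ≤ b) (hf : ContinuousOn f (Icc 0 b))
    (hf' : ∀ t ∈ Ioo 0 b, t ∉ N' → HasDerivAt f (pullback c D t) t) :
    ∫ t in (0 : ℝ)..b, pullback c D t = f b - f 0 :=
  MeasureTheory.integral_eq_of_hasDerivAt_off_countable_of_le f _ hb hN'.countable hf
    (fun t ht => hf' t ht.1 ht.2) (h.intervalIntegrable_pullback hc 0 b)

end IsShapePath

/-- The orientation at time `t` of the swimmer with shape path `φ`. -/
noncomputable def heading (ct : ℝ) (L : Fin 3 → ℝ) (φ D : ℝ → Fin 2 → ℝ) (t : ℝ) : ℝ :=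
  ∫ τ in (0 : ℝ)..t, pullback (fun τ => dynMatrix ct L 0 (φ τ) 2) D τ

/-- The coefficients of the `i`-th velocity component of the swimmer with shape path `φ`, as a
one-form in the joint angles. -/
noncomputable def velocityForm (ct : ℝ) (L : Fin 3 → ℝ) (φ D : ℝ → Fin 2 → ℝ) (i : Fin 3)
    (t : ℝ) : Fin 2 → ℝ :=
  (rotation (heading ct L φ D t) * dynMatrix ct L 0 (φ t)) i

section Motion

variable {ct : ℝ} {L : Fin 3 → ℝ} {φ D : ℝ → Fin 2 → ℝ} {N : Set ℝ}

theorem continuous_dynMatrix_path (hct : 0 < ct) (hL : ∀ i, 0 < L i) (h : IsShapePath φ D N)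
    (i : Fin 3) (j : Fin 2) : Continuous fun t => dynMatrix ct L 0 (φ t) i j :=
  ((continuous_dynMatrix_zero hct hL).comp h.continuous).matrix_elem i j

theorem continuous_heading (hct : 0 < ct) (hL : ∀ i, 0 < L i) (h : IsShapePath φ D N) :
    Continuous (heading ct L φ D) :=
  h.continuous_integral_pullback (continuous_dynMatrix_path hct hL h 2)

theorem continuous_velocityForm (hct : 0 < ct) (hL : ∀ i, 0 < L i) (h : IsShapePath φ D N)
    (i : Fin 3) (j : Fin 2) : Continuous fun t => velocityForm ct L φ D i t j := by
  have hθ := continuous_heading hct hL h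
  have hG := continuous_dynMatrix_path hct hL h
  have h0 := hG 0 j
  have h1 := hG 1 j
  have h2 := hG 2 j
  fin_cases i <;>
    simp [velocityForm, rotation, Matrix.mul_apply, Fin.sum_univ_three] <;> fun_prop

theorem velocityForm_two (t : ℝ) :
    velocityForm ct L φ D 2 t = dynMatrix ct L 0 (φ t) 2 := by
  ext j
  simp [velocityForm, rotation, Matrix.mul_apply, Fin.sum_univ_three]

theorem velocityForm_zero (t : ℝ) (j : Fin 2) :
    velocityForm ct L φ D 0 t j = Real.cos (heading ct L φ D t) * dynMatrix ct L 0 (φ t) 0 j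
      - Real.sin (heading ct L φ D t) * dynMatrix ct L 0 (φ t) 1 j := by
  simp [velocityForm, rotation, Matrix.mul_apply, Fin.sum_univ_three, sub_eq_add_neg]

theorem mulVec_dynMatrix_apply {q : Fin 3 → ℝ} {t : ℝ} (hq : q 2 = heading ct L φ D t)
    (i : Fin 3) :
    (dynMatrix ct L q (φ t)).mulVec (D t) i = pullback (velocityForm ct L φ D i) D t := by
  rw [dynMatrix_eq_rotation, hq]
  simp [Matrix.mulVec, dotProduct, Fin.sum_univ_two, pullback, velocityForm]

/-- Along every motion the orientation is `heading`: the angular velocity depends on the shape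
only, not on `q`. -/
theorem IsMotion.orientation_eq {T : ℝ} {q : ℝ → Fin 3 → ℝ} (hct : 0 < ct) (hL : ∀ i, 0 < L i)
    (h : IsShapePath φ D N) (hq : IsMotion ct L φ T q) {t : ℝ} (ht : t ∈ Icc 0 T) :
    q t 2 = heading ct L φ D t := by
  obtain ⟨N', hN', hdyn⟩ := hq.dynamics
  have key := h.integral_pullback_eq_sub (continuous_dynMatrix_path hct hL h 2)
    (hN'.union h.finite) ht.1 (f := fun t => q t 2)
    ((continuousOn_pi.mp hq.continuousOn 2).mono (Icc_subset_Icc_right ht.2)) ?_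
  · rw [hq.orientation_zero, sub_zero] at key
    exact key.symm
  · intro τ hτ hN
    rw [Set.mem_union, not_or] at hN
    obtain ⟨dφ, hd, hdq⟩ := hdyn τ ⟨⟨hτ.1, hτ.2.trans_le ht.2⟩, hN.1⟩
    obtain rfl := hd.unique (h.hasDerivAt τ hN.2)
    have := hasDerivAt_pi.mp hdq 2
    rw [dynMatrix_eq_rotation] at this
    simpa [Matrix.mulVec, dotProduct, Fin.sum_univ_two, pullback, rotation, Matrix.mul_apply,
      Fin.sum_univ_three] using this

/-- A shape path determines the net displacement, which is the integral of a one-form in the joint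
angles. -/
theorem IsShapePath.hasNetDisplacement {T : ℝ} (hct : 0 < ct) (hL : ∀ i, 0 < L i)
    (h : IsShapePath φ D N) (hT : 0 ≤ T) :
    HasNetDisplacement ct L φ T (∫ t in (0 : ℝ)..T, pullback (velocityForm ct L φ D 0) D t) := by
  refine ⟨⟨fun t i => ∫ τ in (0 : ℝ)..t, pullback (velocityForm ct L φ D i) D τ, ?_, ?_, N,
    h.finite, ?_⟩, ?_⟩
  · exact (continuous_pi fun i =>
      h.continuous_integral_pullback (continuous_velocityForm hct hL h i)).continuousOn
  · simp
  · intro t ht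
    refine ⟨D t, h.hasDerivAt t ht.2, hasDerivAt_pi.mpr fun i => ?_⟩
    rw [mulVec_dynMatrix_apply]
    · exact h.hasDerivAt_integral_pullback (continuous_velocityForm hct hL h i) ht.2
    · simp only [pullback, velocityForm_two, heading]
  · intro q hq
    obtain ⟨N', hN', hdyn⟩ := hq.dynamics
    refine (h.integral_pullback_eq_sub (continuous_velocityForm hct hL h 0) (hN'.union h.finite)
      hT (f := fun t => q t 0) (continuousOn_pi.mp hq.continuousOn 0) ?_).symm
    intro t ht hN
    rw [Set.mem_union, not_or] at hN
    obtain ⟨dφ, hd, hdq⟩ := hdyn t ⟨ht, hN.1⟩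
    obtain rfl := hd.unique (h.hasDerivAt t hN.2)
    rw [← mulVec_dynMatrix_apply (hq.orientation_eq hct hL h (Ioo_subset_Icc_self ht))]
    exact hasDerivAt_pi.mp hdq 0

end Motion

/-! ### The force and torque balance of the symmetric swimmer -/

/-- The entries of `Rbb` at orientation `0` for the symmetric swimmer with dimensionless lengths
`a, b, b`, in units of `ct` and of the total length `l`. -/
theorem Rbb_zero_eq (ct l a b : ℝ) (φ : Fin 2 → ℝ) :
    Rbb ct ![a * l, b * l, b * l] 0 φ =
      !![ct * l * (a + 2 * b + b * (Real.sin (φ 0) ^ 2 + Real.sin (φ 1) ^ 2)),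
         ct * l * (b * (Real.sin (φ 0) * Real.cos (φ 0) - Real.sin (φ 1) * Real.cos (φ 1))),
         ct * l ^ 2 * (-(a * b / 2) * (Real.sin (φ 0) * Real.cos (φ 0)
            + Real.sin (φ 1) * Real.cos (φ 1)) - b ^ 2 * (Real.sin (φ 0) + Real.sin (φ 1)));
         ct * l * (b * (Real.sin (φ 0) * Real.cos (φ 0) - Real.sin (φ 1) * Real.cos (φ 1))),
         ct * l * (2 * (a + 2 * b) - b * (Real.sin (φ 0) ^ 2 + Real.sin (φ 1) ^ 2)),
         ct * l ^ 2 * (a * b / 2 * (Real.sin (φ 0) ^ 2 - Real.sin (φ 1) ^ 2)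
            + b ^ 2 * (Real.cos (φ 1) - Real.cos (φ 0)));
         ct * l ^ 2 * (-(a * b / 2) * (Real.sin (φ 0) * Real.cos (φ 0)
            + Real.sin (φ 1) * Real.cos (φ 1)) - b ^ 2 * (Real.sin (φ 0) + Real.sin (φ 1))),
         ct * l ^ 2 * (a * b / 2 * (Real.sin (φ 0) ^ 2 - Real.sin (φ 1) ^ 2)
            + b ^ 2 * (Real.cos (φ 1) - Real.cos (φ 0))),
         ct * l ^ 3 * ((a ^ 3 + 2 * b ^ 3) / 6 + b * (a ^ 2 / 4 * (4 - Real.sin (φ 0) ^ 2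
            - Real.sin (φ 1) ^ 2) + a * b * (Real.cos (φ 0) + Real.cos (φ 1)) + b ^ 2))] := by
  have h0 := Real.sin_sq_add_cos_sq (φ 0)
  have h1 := Real.sin_sq_add_cos_sq (φ 1)
  ext i j
  fin_cases i <;> fin_cases j <;>
    simp [Rbb, bodyJac, resistance, linkPos, jointPos, linkAngle, axial, Matrix.mul_apply,
      Fin.sum_univ_three, -mul_eq_mul_left_iff, -mul_eq_mul_right_iff]
  all_goals generalize Real.sin (φ 0) = s at *
  all_goals generalize Real.sin (φ 1) = s' at *
  all_goals generalize Real.cos (φ 0) = c at *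
  all_goals generalize Real.cos (φ 1) = c' at *
  all_goals grind

theorem Rbu_zero_eq (ct l a b : ℝ) (φ : Fin 2 → ℝ) :
    Rbu ct ![a * l, b * l, b * l] 0 φ =
      !![ct * l ^ 2 * (b ^ 2 * Real.sin (φ 0)), ct * l ^ 2 * (-(b ^ 2) * Real.sin (φ 1));
         ct * l ^ 2 * (b ^ 2 * Real.cos (φ 0)), ct * l ^ 2 * (b ^ 2 * Real.cos (φ 1));
         ct * l ^ 3 * (-(a * b ^ 2 / 2) * Real.cos (φ 0) - 2 * b ^ 3 / 3),
         ct * l ^ 3 * (a * b ^ 2 / 2 * Real.cos (φ 1) + 2 * b ^ 3 / 3)] := by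
  have h0 := Real.sin_sq_add_cos_sq (φ 0)
  have h1 := Real.sin_sq_add_cos_sq (φ 1)
  ext i j
  fin_cases i <;> fin_cases j <;>
    simp [Rbu, shapeJac, indicator, bodyJac, resistance, linkPos, jointPos, linkAngle, axial,
      Matrix.mul_apply,
      Fin.sum_univ_three, -mul_eq_mul_left_iff, -mul_eq_mul_right_iff]
  all_goals generalize Real.sin (φ 0) = s at *
  all_goals generalize Real.sin (φ 1) = s' at *
  all_goals generalize Real.cos (φ 0) = c at *
  all_goals generalize Real.cos (φ 1) = c' at *
  all_goals grind

theorem Rbb_mul_dynMatrix {ct : ℝ} {L : Fin 3 → ℝ} (hct : 0 < ct) (hL : ∀ i, 0 < L i)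
    (φ : Fin 2 → ℝ) : Rbb ct L 0 φ * dynMatrix ct L 0 φ = -Rbu ct L 0 φ := by
  rw [dynMatrix, Matrix.mul_neg, Pi.zero_apply,
    Matrix.mul_nonsing_inv_cancel_left _ _ (isUnit_det_Rbb hct hL 0 φ)]

/-- The force and torque balance in dimensionless form, for the velocities caused by a unit rate of
the `j`-th joint angle: `g`, `k` are the components of the linear velocity in units of `l`, and `w`
is the angular velocity. -/
theorem balance_equations {ct l a b : ℝ} (hct : 0 < ct) (hl : 0 < l) (ha : 0 < a) (hb : 0 < b)
    (hab : a + 2 * b = 1) (φ : Fin 2 → ℝ) (j : Fin 2) {g k w : ℝ}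
    (hg : dynMatrix ct ![a * l, b * l, b * l] 0 φ 0 j = l * g)
    (hk : dynMatrix ct ![a * l, b * l, b * l] 0 φ 1 j = l * k)
    (hw : dynMatrix ct ![a * l, b * l, b * l] 0 φ 2 j = w) :
    (1 + b * (Real.sin (φ 0) ^ 2 + Real.sin (φ 1) ^ 2)) * g
      + b * (Real.sin (φ 0) * Real.cos (φ 0) - Real.sin (φ 1) * Real.cos (φ 1)) * k
      + (-(a * b / 2) * (Real.sin (φ 0) * Real.cos (φ 0) + Real.sin (φ 1) * Real.cos (φ 1))
          - b ^ 2 * (Real.sin (φ 0) + Real.sin (φ 1))) * w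
      + ![b ^ 2 * Real.sin (φ 0), -(b ^ 2) * Real.sin (φ 1)] j = 0 ∧
    b * (Real.sin (φ 0) * Real.cos (φ 0) - Real.sin (φ 1) * Real.cos (φ 1)) * g
      + (2 - b * (Real.sin (φ 0) ^ 2 + Real.sin (φ 1) ^ 2)) * k
      + (a * b / 2 * (Real.sin (φ 0) ^ 2 - Real.sin (φ 1) ^ 2)
          + b ^ 2 * (Real.cos (φ 1) - Real.cos (φ 0))) * w
      + ![b ^ 2 * Real.cos (φ 0), b ^ 2 * Real.cos (φ 1)] j = 0 ∧
    (-(a * b / 2) * (Real.sin (φ 0) * Real.cos (φ 0) + Real.sin (φ 1) * Real.cos (φ 1))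
          - b ^ 2 * (Real.sin (φ 0) + Real.sin (φ 1))) * g
      + (a * b / 2 * (Real.sin (φ 0) ^ 2 - Real.sin (φ 1) ^ 2)
          + b ^ 2 * (Real.cos (φ 1) - Real.cos (φ 0))) * k
      + ((a ^ 3 + 2 * b ^ 3) / 6 + b * (a ^ 2 / 4 * (4 - Real.sin (φ 0) ^ 2
            - Real.sin (φ 1) ^ 2) + a * b * (Real.cos (φ 0) + Real.cos (φ 1)) + b ^ 2)) * w
      + ![-(a * b ^ 2 / 2) * Real.cos (φ 0) - 2 * b ^ 3 / 3,
          a * b ^ 2 / 2 * Real.cos (φ 1) + 2 * b ^ 3 / 3] j = 0 := by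
  have hL : ∀ i, 0 < ![a * l, b * l, b * l] i := by
    intro i
    fin_cases i <;> simp <;> positivity
  have hmul := Rbb_mul_dynMatrix hct hL φ
  rw [Rbb_zero_eq, Rbu_zero_eq] at hmul
  have h0 := congrFun (congrFun hmul 0) j
  have h1 := congrFun (congrFun hmul 1) j
  have h2 := congrFun (congrFun hmul 2) j
  simp only [Matrix.mul_apply, Fin.sum_univ_three, hg, hk, hw, hab, Matrix.neg_apply] at h0 h1 h2
  have c2 : ct * l ^ 2 ≠ 0 := by positivity
  have c3 : ct * l ^ 3 ≠ 0 := by positivity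
  refine ⟨mul_left_cancel₀ c2 ?_, mul_left_cancel₀ c2 ?_, mul_left_cancel₀ c3 ?_⟩
  · fin_cases j <;> simp [-mul_eq_zero, -mul_eq_mul_left_iff] at h0 ⊢ <;> linear_combination h0
  · fin_cases j <;> simp [-mul_eq_zero, -mul_eq_mul_left_iff] at h1 ⊢ <;> linear_combination h1
  · fin_cases j <;> simp [-mul_eq_zero, -mul_eq_mul_left_iff] at h2 ⊢ <;> linear_combination h2

/-! ### Perturbative solution of the balance equations -/

section Orders

variable {α : Type*} {F : Filter α} {r : α → ℝ}

theorem isBigO_pow_mono (hr : r =O[F] fun _ => (1 : ℝ)) {m n : ℕ} (hmn : n ≤ m) {f : α → ℝ}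
    (hf : f =O[F] fun x => r x ^ m) : f =O[F] fun x => r x ^ n := by
  refine hf.trans ?_
  have h := (hr.pow (m - n)).mul (isBigO_refl (fun x => r x ^ n) F)
  refine (h.congr (fun _ => ?_) (fun _ => ?_))
  · rw [← pow_add, Nat.sub_add_cancel hmn]
  · simp

/-- Orders of smallness add under multiplication. -/
theorem isBigO_pow_mul (hr : r =O[F] fun _ => (1 : ℝ)) {m n k : ℕ} {f g : α → ℝ}
    (hf : f =O[F] fun x => r x ^ m) (hg : g =O[F] fun x => r x ^ n)
    (hk : k ≤ m + n := by norm_num) :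
    (fun x => f x * g x) =O[F] fun x => r x ^ k :=
  isBigO_pow_mono hr hk ((hf.mul hg).congr_right fun _ => (pow_add _ _ _).symm)

theorem isBigO_pow_zero_of_const (c : ℝ) : (fun _ => c) =O[F] fun x => r x ^ 0 := by
  simpa using isBigO_const_const c (one_ne_zero (α := ℝ)) F

theorem isBigO_linear {u v : α → ℝ} (hu : u =O[F] r) (hv : v =O[F] r) (a b : ℝ) :
    (fun x => a * u x + b * v x) =O[F] fun x => r x ^ 1 := by
  simpa using (hu.const_mul_left a).add (hv.const_mul_left b)

theorem isBigO_quadratic {u v : α → ℝ} (hu : u =O[F] r) (hv : v =O[F] r) (a b c : ℝ) :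
    (fun x => a * u x ^ 2 + b * (u x * v x) + c * v x ^ 2) =O[F] fun x => r x ^ 2 := by
  refine (((hu.pow 2).const_mul_left a).add (IsBigO.const_mul_left ?_ b)).add
    ((hv.pow 2).const_mul_left c)
  simpa [sq] using hu.mul hv

theorem isBigO_cubic {u v : α → ℝ} (hu : u =O[F] r) (hv : v =O[F] r) (a b c d : ℝ) :
    (fun x => a * u x ^ 3 + b * (u x ^ 2 * v x) + c * (u x * v x ^ 2) + d * v x ^ 3)
      =O[F] fun x => r x ^ 3 := by
  refine ((((hu.pow 3).const_mul_left a).add (IsBigO.const_mul_left ?_ b)).add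
    (IsBigO.const_mul_left ?_ c)).add ((hv.pow 3).const_mul_left d)
  · exact ((hu.pow 2).mul hv).congr_right fun x => by ring
  · exact (hu.mul (hv.pow 2)).congr_right fun x => by ring

/-- Perturbative solution of a `3 × 3` linear system `R (g, k, w) = -B` whose matrix is close to
`diag(1, 2, κ)`.  In each entry of `R` and `B` only the terms of one parity occur up to the
order considered (the digit in `X2`, `Y1` and so on is the order of the term), as is the case for a
mechanical system with a mirror symmetry.  If `G1 + G3`, `k0 + K2`, `w0 + W2` solve the system
order by order, then they approximate the solution, the first component to order `5` and the other
two to order `4`. -/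
theorem isBigO_sub_of_perturbed_system (hr0 : Tendsto r F (𝓝 0)) {κ k0 w0 p0 q0 : ℝ}
    (hκ : κ ≠ 0)
    {R00 R01 R02 R11 R12 R22 B0 B1 B2 g k w : α → ℝ}
    {X2 Y1 Y3 Z1 Z3 V2 D2 M2 b1 b3 p2 q2 G1 G3 K2 W2 : α → ℝ}
    (eq0 : ∀ x, R00 x * g x + R01 x * k x + R02 x * w x + B0 x = 0)
    (eq1 : ∀ x, R01 x * g x + R11 x * k x + R12 x * w x + B1 x = 0)
    (eq2 : ∀ x, R02 x * g x + R12 x * k x + R22 x * w x + B2 x = 0)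
    (h00 : (fun x => R00 x - (1 + X2 x)) =O[F] fun x => r x ^ 4)
    (h01 : (fun x => R01 x - (Y1 x + Y3 x)) =O[F] fun x => r x ^ 5)
    (h02 : (fun x => R02 x - (Z1 x + Z3 x)) =O[F] fun x => r x ^ 5)
    (h11 : (fun x => R11 x - (2 + V2 x)) =O[F] fun x => r x ^ 4)
    (h12 : (fun x => R12 x - D2 x) =O[F] fun x => r x ^ 4)
    (h22 : (fun x => R22 x - (κ + M2 x)) =O[F] fun x => r x ^ 4)
    (hB0 : (fun x => B0 x - (b1 x + b3 x)) =O[F] fun x => r x ^ 5)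
    (hB1 : (fun x => B1 x - (p0 + p2 x)) =O[F] fun x => r x ^ 4)
    (hB2 : (fun x => B2 x - (q0 + q2 x)) =O[F] fun x => r x ^ 4)
    (hX2 : X2 =O[F] fun x => r x ^ 2) (hY1 : Y1 =O[F] fun x => r x ^ 1)
    (hY3 : Y3 =O[F] fun x => r x ^ 3) (hZ1 : Z1 =O[F] fun x => r x ^ 1)
    (hZ3 : Z3 =O[F] fun x => r x ^ 3) (hV2 : V2 =O[F] fun x => r x ^ 2)
    (hD2 : D2 =O[F] fun x => r x ^ 2) (hM2 : M2 =O[F] fun x => r x ^ 2)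
    (hG1 : G1 =O[F] fun x => r x ^ 1) (hG3 : G3 =O[F] fun x => r x ^ 3)
    (hK2 : K2 =O[F] fun x => r x ^ 2) (hW2 : W2 =O[F] fun x => r x ^ 2)
    (o01 : ∀ x, G1 x + Y1 x * k0 + Z1 x * w0 + b1 x = 0)
    (o03 : ∀ x, G3 x + X2 x * G1 x + Y1 x * K2 x + Y3 x * k0 + Z1 x * W2 x + Z3 x * w0
      + b3 x = 0)
    (o10 : 2 * k0 + p0 = 0)
    (o12 : ∀ x, Y1 x * G1 x + 2 * K2 x + V2 x * k0 + D2 x * w0 + p2 x = 0)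
    (o20 : κ * w0 + q0 = 0)
    (o22 : ∀ x, Z1 x * G1 x + D2 x * k0 + κ * W2 x + M2 x * w0 + q2 x = 0)
    (hg : g =O[F] fun _ => (1 : ℝ)) (hk : k =O[F] fun _ => (1 : ℝ))
    (hw : w =O[F] fun _ => (1 : ℝ)) :
    (fun x => g x - (G1 x + G3 x)) =O[F] (fun x => r x ^ 5) ∧
    (fun x => k x - (k0 + K2 x)) =O[F] (fun x => r x ^ 4) ∧
    (fun x => w x - (w0 + W2 x)) =O[F] (fun x => r x ^ 4) := by
  have hr : r =O[F] fun _ => (1 : ℝ) := hr0.isBigO_one ℝ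
  have c0 : ∀ c : ℝ, (fun _ => c) =O[F] fun x => r x ^ 0 := isBigO_pow_zero_of_const
  have lo : ∀ {m : ℕ} (n : ℕ) {f : α → ℝ}, (f =O[F] fun x => r x ^ m) → n ≤ m →
      f =O[F] fun x => r x ^ n := fun n f hf h => isBigO_pow_mono hr h hf
  have hG : (fun x => G1 x + G3 x) =O[F] fun x => r x ^ 1 := hG1.add (lo 1 hG3 (by norm_num))
  have hK : (fun x => k0 + K2 x) =O[F] fun x => r x ^ 0 := (c0 _).add (lo 0 hK2 (by norm_num))
  have hW : (fun x => w0 + W2 x) =O[F] fun x => r x ^ 0 := (c0 _).add (lo 0 hW2 (by norm_num))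
  -- The residuals of the approximate solution.
  have res0 : (fun x => R00 x * (G1 x + G3 x) + R01 x * (k0 + K2 x) + R02 x * (w0 + W2 x) + B0 x)
      =O[F] fun x => r x ^ 5 := by
    refine (((((((isBigO_pow_mul hr h00 hG).add (isBigO_pow_mul hr h01 hK)).add
      (isBigO_pow_mul hr h02 hW)).add hB0).add (isBigO_pow_mul hr hX2 hG3)).add
      (isBigO_pow_mul hr hY3 hK2)).add (isBigO_pow_mul hr hZ3 hW2)).congr_left fun x => ?_
    linear_combination -o01 x - o03 x
  have res1 : (fun x => R01 x * (G1 x + G3 x) + R11 x * (k0 + K2 x) + R12 x * (w0 + W2 x) + B1 x)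
      =O[F] fun x => r x ^ 4 := by
    refine ((((((((isBigO_pow_mul hr h01 hG).add (isBigO_pow_mul hr h11 hK)).add
      (isBigO_pow_mul hr h12 hW)).add hB1).add (isBigO_pow_mul hr hY1 hG3)).add
      (isBigO_pow_mul hr hY3 hG)).add (isBigO_pow_mul hr hV2 hK2)).add
      (isBigO_pow_mul hr hD2 hW2)).congr_left fun x => ?_
    linear_combination -o10 - o12 x
  have res2 : (fun x => R02 x * (G1 x + G3 x) + R12 x * (k0 + K2 x) + R22 x * (w0 + W2 x) + B2 x)
      =O[F] fun x => r x ^ 4 := by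
    refine ((((((((isBigO_pow_mul hr h02 hG).add (isBigO_pow_mul hr h12 hK)).add
      (isBigO_pow_mul hr h22 hW)).add hB2).add (isBigO_pow_mul hr hZ1 hG3)).add
      (isBigO_pow_mul hr hZ3 hG)).add (isBigO_pow_mul hr hM2 hW2)).add
      (isBigO_pow_mul hr hD2 hK2)).congr_left fun x => ?_
    linear_combination -o20 - o22 x
  have d00 : (fun x => R00 x - 1) =O[F] fun x => r x ^ 1 :=
    ((lo 1 h00 (by norm_num)).add (lo 1 hX2 (by norm_num))).congr_left fun x => by ring
  have d01 : R01 =O[F] fun x => r x ^ 1 :=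
    (((lo 1 h01 (by norm_num)).add hY1).add (lo 1 hY3 (by norm_num))).congr_left fun x => by ring
  have d02 : R02 =O[F] fun x => r x ^ 1 :=
    (((lo 1 h02 (by norm_num)).add hZ1).add (lo 1 hZ3 (by norm_num))).congr_left fun x => by ring
  have d11 : (fun x => R11 x - 2) =O[F] fun x => r x ^ 1 :=
    ((lo 1 h11 (by norm_num)).add (lo 1 hV2 (by norm_num))).congr_left fun x => by ring
  have d12 : R12 =O[F] fun x => r x ^ 1 :=
    ((lo 1 h12 (by norm_num)).add (lo 1 hD2 (by norm_num))).congr_left fun x => by ring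
  have d22 : (fun x => R22 x - κ) =O[F] fun x => r x ^ 1 :=
    ((lo 1 h22 (by norm_num)).add (lo 1 hM2 (by norm_num))).congr_left fun x => by ring
  -- Bootstrap: a bound of order `n` for the errors gives one of order `n + 1`.
  have step0 : ∀ n ≤ 4, ((fun x => g x - (G1 x + G3 x)) =O[F] fun x => r x ^ n) →
      ((fun x => k x - (k0 + K2 x)) =O[F] fun x => r x ^ n) →
      ((fun x => w x - (w0 + W2 x)) =O[F] fun x => r x ^ n) →
      (fun x => g x - (G1 x + G3 x)) =O[F] fun x => r x ^ (n + 1) := by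
    intro n hn eg ek ew
    refine (((((isBigO_pow_mul hr d00 eg (k := n + 1) (by omega)).add
      (isBigO_pow_mul hr d01 ek (k := n + 1) (by omega))).add
      (isBigO_pow_mul hr d02 ew (k := n + 1) (by omega))).add
      (lo (n + 1) res0 (by omega))).neg_left).congr_left fun x => ?_
    linear_combination -eq0 x
  have step1 : ∀ n ≤ 3, ((fun x => g x - (G1 x + G3 x)) =O[F] fun x => r x ^ n) →
      ((fun x => k x - (k0 + K2 x)) =O[F] fun x => r x ^ n) →
      ((fun x => w x - (w0 + W2 x)) =O[F] fun x => r x ^ n) →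
      (fun x => k x - (k0 + K2 x)) =O[F] fun x => r x ^ (n + 1) := by
    intro n hn eg ek ew
    refine ((((((isBigO_pow_mul hr d01 eg (k := n + 1) (by omega)).add
      (isBigO_pow_mul hr d11 ek (k := n + 1) (by omega))).add
      (isBigO_pow_mul hr d12 ew (k := n + 1) (by omega))).add
      (lo (n + 1) res1 (by omega)))).const_mul_left (-1 / 2)).congr_left fun x => ?_
    linear_combination -1 / 2 * eq1 x
  have step2 : ∀ n ≤ 3, ((fun x => g x - (G1 x + G3 x)) =O[F] fun x => r x ^ n) →
      ((fun x => k x - (k0 + K2 x)) =O[F] fun x => r x ^ n) →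
      ((fun x => w x - (w0 + W2 x)) =O[F] fun x => r x ^ n) →
      (fun x => w x - (w0 + W2 x)) =O[F] fun x => r x ^ (n + 1) := by
    intro n hn eg ek ew
    refine ((((((isBigO_pow_mul hr d02 eg (k := n + 1) (by omega)).add
      (isBigO_pow_mul hr d12 ek (k := n + 1) (by omega))).add
      (isBigO_pow_mul hr d22 ew (k := n + 1) (by omega))).add
      (lo (n + 1) res2 (by omega)))).const_mul_left (-κ⁻¹)).congr_left fun x => ?_
    have := mul_inv_cancel₀ hκ
    linear_combination -κ⁻¹ * eq2 x + (w x - (w0 + W2 x)) * this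
  have boot : ∀ n ≤ 4, ((fun x => g x - (G1 x + G3 x)) =O[F] fun x => r x ^ n) ∧
      ((fun x => k x - (k0 + K2 x)) =O[F] fun x => r x ^ n) ∧
      ((fun x => w x - (w0 + W2 x)) =O[F] fun x => r x ^ n) := by
    intro n
    induction n with
    | zero =>
      intro _
      refine ⟨IsBigO.sub ?_ (lo 0 hG (by norm_num)), IsBigO.sub ?_ hK, IsBigO.sub ?_ hW⟩ <;>
        simpa only [pow_zero]
    | succ n ih =>
      intro hn
      obtain ⟨eg, ek, ew⟩ := ih (by omega)
      exact ⟨step0 n (by omega) eg ek ew, step1 n (by omega) eg ek ew,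
        step2 n (by omega) eg ek ew⟩
  obtain ⟨eg, ek, ew⟩ := boot 4 le_rfl
  exact ⟨step0 4 le_rfl eg ek ew, ek, ew⟩

end Orders

section Trig

theorem isBigO_sin_sub_cubic :
    (fun x : ℝ => Real.sin x - (x - x ^ 3 / 6)) =O[𝓝 0] fun x => x ^ 5 := by
  refine IsBigO.of_bound 1 ?_
  filter_upwards [Metric.closedBall_mem_nhds (0 : ℝ) one_pos] with x hx
  have hx1 : ‖(x : ℂ) * Complex.I‖ ≤ 1 := by simpa using hx
  have h := Complex.exp_bound hx1 (n := 5) (by norm_num)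
  have h' := (Complex.abs_im_le_norm _).trans h
  have e : (Complex.exp (x * Complex.I)
      - ∑ m ∈ Finset.range 5, ((x : ℂ) * Complex.I) ^ m / (m.factorial : ℂ)).im
      = Real.sin x - (x - x ^ 3 / 6) := by
    have h2 : Complex.I ^ 2 = -1 := Complex.I_sq
    have h3 : Complex.I ^ 3 = -Complex.I := by rw [pow_succ, h2]; ring
    have h4 : Complex.I ^ 4 = 1 := Complex.I_pow_four
    have : ∑ m ∈ Finset.range 5, ((x : ℂ) * Complex.I) ^ m / (m.factorial : ℂ)
        = ((1 - x ^ 2 / 2 + x ^ 4 / 24 : ℝ) : ℂ) + ((x - x ^ 3 / 6 : ℝ) : ℂ) * Complex.I := by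
      simp only [Finset.sum_range_succ, Finset.sum_range_zero, mul_pow, h2, h3, h4,
        Nat.factorial]
      push_cast
      ring
    rw [this, Complex.exp_mul_I, ← Complex.ofReal_cos, ← Complex.ofReal_sin]
    simp only [Complex.sub_im, Complex.add_im, Complex.ofReal_im,
      Complex.im_ofReal_mul, Complex.I_im]
    ring
  rw [e] at h'
  rw [Real.norm_eq_abs, norm_pow, one_mul, Real.norm_eq_abs]
  refine h'.trans ?_
  have hn : ‖(x : ℂ) * Complex.I‖ = |x| := by simp
  rw [hn]
  refine mul_le_of_le_one_right (by positivity) ?_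
  norm_num [Nat.factorial]

theorem isBigO_cos_sub_quadratic :
    (fun x : ℝ => Real.cos x - (1 - x ^ 2 / 2)) =O[𝓝 0] fun x => x ^ 4 := by
  refine IsBigO.of_bound (5 / 96) ?_
  filter_upwards [Metric.closedBall_mem_nhds (0 : ℝ) one_pos] with x hx
  have := Real.cos_bound (x := x) (by simpa using hx)
  rw [Real.norm_eq_abs, norm_pow, Real.norm_eq_abs]
  linarith

variable {α : Type*} {F : Filter α} {r u : α → ℝ}

theorem isBigO_sin_comp (hr : Tendsto r F (𝓝 0)) (hu : u =O[F] r) :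
    (fun x => Real.sin (u x) - (u x - u x ^ 3 / 6)) =O[F] fun x => r x ^ 5 :=
  (isBigO_sin_sub_cubic.comp_tendsto (hu.trans_tendsto hr)).trans (hu.pow 5)

theorem isBigO_cos_comp (hr : Tendsto r F (𝓝 0)) (hu : u =O[F] r) :
    (fun x => Real.cos (u x) - (1 - u x ^ 2 / 2)) =O[F] fun x => r x ^ 4 :=
  (isBigO_cos_sub_quadratic.comp_tendsto (hu.trans_tendsto hr)).trans (hu.pow 4)

theorem isBigO_sin_mul_cos_comp (hr : Tendsto r F (𝓝 0)) (hu : u =O[F] r) :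
    (fun x => Real.sin (u x) * Real.cos (u x) - (u x - 2 / 3 * u x ^ 3))
      =O[F] fun x => r x ^ 5 := by
  refine ((isBigO_sin_comp hr (hu.const_mul_left 2)).const_mul_left (1 / 2)).congr_left
    fun x => ?_
  rw [Real.sin_two_mul]
  ring

theorem isBigO_sin_sq_comp (hr : Tendsto r F (𝓝 0)) (hu : u =O[F] r) :
    (fun x => Real.sin (u x) ^ 2 - u x ^ 2) =O[F] fun x => r x ^ 4 := by
  refine ((isBigO_cos_comp hr (hu.const_mul_left 2)).const_mul_left (-1 / 2)).congr_left
    fun x => ?_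
  rw [Real.cos_two_mul]
  linear_combination -Real.sin_sq_add_cos_sq (u x)

end Trig

/-! ### Taylor expansion of the velocities at the straight shape -/

/-- The coefficients of the Taylor expansion at the straight shape of the velocities
`(v_x, v_y, ω)` caused by a unit rate of the first joint angle, to the order needed:
`v_x = x10 u + x01 v + x30 u³ + x21 u²v + x12 uv² + x03 v³`, and `v_y`, `ω` are even quadratics. -/
structure VelocityCoeffs where
  (x10 x01 x30 x21 x12 x03 y00 y20 y11 y02 w00 w20 w11 w02 : ℝ)

namespace VelocityCoeffs

/-- The linear part of `v_x`. -/
def x1 (c : VelocityCoeffs) (u v : ℝ) : ℝ := c.x10 * u + c.x01 * v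

/-- The cubic part of `v_x`. -/
def x3 (c : VelocityCoeffs) (u v : ℝ) : ℝ :=
  c.x30 * u ^ 3 + c.x21 * (u ^ 2 * v) + c.x12 * (u * v ^ 2) + c.x03 * v ^ 3

/-- The quadratic part of `v_y`. -/
def y2 (c : VelocityCoeffs) (u v : ℝ) : ℝ :=
  c.y20 * u ^ 2 + c.y11 * (u * v) + c.y02 * v ^ 2

/-- The quadratic part of `ω`. -/
def w2 (c : VelocityCoeffs) (u v : ℝ) : ℝ :=
  c.w20 * u ^ 2 + c.w11 * (u * v) + c.w02 * v ^ 2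

end VelocityCoeffs

/-- `c` gives the Taylor expansion of the velocities `G`.  The mirror symmetry of the swimmer that
exchanges the two joints is built in: the second column of `G` is the first one with the arguments
exchanged, up to the signs `-, +, -`. -/
structure HasVelocityExpansion (G : (Fin 2 → ℝ) → Matrix (Fin 3) (Fin 2) ℝ)
    (c : VelocityCoeffs) : Prop where
  x_fst : (fun φ => G φ 0 0 - (c.x1 (φ 0) (φ 1) + c.x3 (φ 0) (φ 1))) =O[𝓝 0] fun φ => ‖φ‖ ^ 5
  x_snd : (fun φ => G φ 0 1 + (c.x1 (φ 1) (φ 0) + c.x3 (φ 1) (φ 0))) =O[𝓝 0] fun φ => ‖φ‖ ^ 5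
  y_fst : (fun φ => G φ 1 0 - (c.y00 + c.y2 (φ 0) (φ 1))) =O[𝓝 0] fun φ => ‖φ‖ ^ 4
  y_snd : (fun φ => G φ 1 1 - (c.y00 + c.y2 (φ 1) (φ 0))) =O[𝓝 0] fun φ => ‖φ‖ ^ 4
  w_fst : (fun φ => G φ 2 0 - (c.w00 + c.w2 (φ 0) (φ 1))) =O[𝓝 0] fun φ => ‖φ‖ ^ 4
  w_snd : (fun φ => G φ 2 1 + (c.w00 + c.w2 (φ 1) (φ 0))) =O[𝓝 0] fun φ => ‖φ‖ ^ 4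

/-- The coefficients of the symmetric swimmer of total length `l` and centre link `η l`. -/
noncomputable def swimmerCoeffs (l η : ℝ) : VelocityCoeffs where
  x10 := l * (-((1 - η) ^ 2 * (1 + η) ^ 2) / 16)
  x01 := l * ((1 - η) ^ 3 * (1 + η) / 16)
  x30 := l * ((1 - η) ^ 2 * (1 + η) ^ 2 * (1 - 6 * η + 9 * η ^ 2) / 384)
  x21 := l * ((1 - η) ^ 3 * (1 + η) * (-1 - 6 * η + 3 * η ^ 2) / 128)
  x12 := l * ((1 - η) ^ 3 * (1 + 9 * η + 3 * η ^ 2 + 3 * η ^ 3) / 128)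
  x03 := l * ((1 - η) ^ 3 * (-1 + 5 * η - 27 * η ^ 2 - 9 * η ^ 3) / 384)
  y00 := l * (-(1 - η) ^ 2 / 8)
  y20 := l * ((1 - η) ^ 2 * (1 + η) ^ 2 / 64)
  y11 := l * (-((1 - η) ^ 3 * (1 + η)) / 32)
  y02 := l * ((1 - η) ^ 3 * (1 + 3 * η) / 64)
  w00 := (1 - η) ^ 2 * (2 + η) / 4
  w20 := -(3 * η * (1 - η) ^ 2 * (1 + η) ^ 2) / 32
  w11 := -(3 * η * (1 - η) ^ 3 * (1 + η)) / 16
  w02 := 3 * η * (1 - η) ^ 3 * (3 + η) / 32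

theorem hasVelocityExpansion_dynMatrix {ct l η : ℝ} (hct : 0 < ct) (hl : 0 < l) (hη : 0 < η)
    (hη1 : η < 1) :
    HasVelocityExpansion (dynMatrix ct ![η * l, (1 - η) / 2 * l, (1 - η) / 2 * l] 0)
      (swimmerCoeffs l η) := by
  have hb : 0 < (1 - η) / 2 := by linarith
  obtain ⟨b, hbη⟩ : ∃ b, b = (1 - η) / 2 := ⟨_, rfl⟩
  rw [← hbη] at hb ⊢
  obtain rfl : η = 1 - 2 * b := by linarith
  have hL : ∀ i, 0 < ![(1 - 2 * b) * l, b * l, b * l] i := by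
    intro i
    fin_cases i <;> simp <;> nlinarith
  have hr0 : Tendsto (fun φ : Fin 2 → ℝ => ‖φ‖) (𝓝 0) (𝓝 0) := tendsto_norm_zero
  have hφ : ∀ j, (fun φ : Fin 2 → ℝ => φ j) =O[𝓝 0] fun φ => ‖φ‖ := fun j =>
    IsBigO.of_bound 1 (Eventually.of_forall fun φ => by simpa using norm_le_pi_norm φ j)
  have hO : ∀ i j, (fun φ => dynMatrix ct ![(1 - 2 * b) * l, b * l, b * l] 0 φ i j)
      =O[𝓝 0] fun _ => (1 : ℝ) := fun i j =>
    ((continuous_dynMatrix_zero hct hL).matrix_elem i j).continuousAt.tendsto.isBigO_one ℝ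
  have hdiv : ∀ x : ℝ, x = l * (l⁻¹ * x) := fun x => by field_simp
  have H := fun φ j => balance_equations hct hl hη hb (by ring) φ j
    (hdiv (dynMatrix ct ![(1 - 2 * b) * l, b * l, b * l] 0 φ 0 j))
    (hdiv (dynMatrix ct ![(1 - 2 * b) * l, b * l, b * l] 0 φ 1 j)) rfl
  have hs := fun j => isBigO_sin_comp hr0 (hφ j)
  have hc := fun j => isBigO_cos_comp hr0 (hφ j)
  have hsc := fun j => isBigO_sin_mul_cos_comp hr0 (hφ j)
  have hss := fun j => isBigO_sin_sq_comp hr0 (hφ j)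
  have h00 : (fun φ : Fin 2 → ℝ => 1 + b * (Real.sin (φ 0) ^ 2 + Real.sin (φ 1) ^ 2)
      - (1 + (b * φ 0 ^ 2 + 0 * (φ 0 * φ 1) + b * φ 1 ^ 2))) =O[𝓝 0] fun φ => ‖φ‖ ^ 4 :=
    (((hss 0).add (hss 1)).const_mul_left b).congr_left fun φ => by ring
  have h11 : (fun φ : Fin 2 → ℝ => 2 - b * (Real.sin (φ 0) ^ 2 + Real.sin (φ 1) ^ 2)
      - (2 + (-b * φ 0 ^ 2 + 0 * (φ 0 * φ 1) + -b * φ 1 ^ 2))) =O[𝓝 0] fun φ => ‖φ‖ ^ 4 :=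
    (((hss 0).add (hss 1)).const_mul_left (-b)).congr_left fun φ => by ring
  have h01 : (fun φ : Fin 2 → ℝ => b * (Real.sin (φ 0) * Real.cos (φ 0)
        - Real.sin (φ 1) * Real.cos (φ 1))
      - ((b * φ 0 + -b * φ 1) + (-2 / 3 * b * φ 0 ^ 3 + 0 * (φ 0 ^ 2 * φ 1)
        + 0 * (φ 0 * φ 1 ^ 2) + 2 / 3 * b * φ 1 ^ 3))) =O[𝓝 0] fun φ => ‖φ‖ ^ 5 :=
    (((hsc 0).sub (hsc 1)).const_mul_left b).congr_left fun φ => by ring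
  have h02 : (fun φ : Fin 2 → ℝ => -((1 - 2 * b) * b / 2) * (Real.sin (φ 0) * Real.cos (φ 0)
        + Real.sin (φ 1) * Real.cos (φ 1)) - b ^ 2 * (Real.sin (φ 0) + Real.sin (φ 1))
      - ((-(b / 2) * φ 0 + -(b / 2) * φ 1) + ((b / 3 - b ^ 2 / 2) * φ 0 ^ 3
        + 0 * (φ 0 ^ 2 * φ 1) + 0 * (φ 0 * φ 1 ^ 2) + (b / 3 - b ^ 2 / 2) * φ 1 ^ 3)))
      =O[𝓝 0] fun φ => ‖φ‖ ^ 5 :=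
    ((((hsc 0).add (hsc 1)).const_mul_left (-((1 - 2 * b) * b / 2))).sub
      (((hs 0).add (hs 1)).const_mul_left (b ^ 2))).congr_left fun φ => by ring
  have h12 : (fun φ : Fin 2 → ℝ => (1 - 2 * b) * b / 2 * (Real.sin (φ 0) ^ 2
        - Real.sin (φ 1) ^ 2) + b ^ 2 * (Real.cos (φ 1) - Real.cos (φ 0))
      - ((b - b ^ 2) / 2 * φ 0 ^ 2 + 0 * (φ 0 * φ 1) + -((b - b ^ 2) / 2) * φ 1 ^ 2))
      =O[𝓝 0] fun φ => ‖φ‖ ^ 4 :=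
    ((((hss 0).sub (hss 1)).const_mul_left ((1 - 2 * b) * b / 2)).add
      (((hc 1).sub (hc 0)).const_mul_left (b ^ 2))).congr_left fun φ => by ring
  have h22 : (fun φ : Fin 2 → ℝ => ((1 - 2 * b) ^ 3 + 2 * b ^ 3) / 6
        + b * ((1 - 2 * b) ^ 2 / 4 * (4 - Real.sin (φ 0) ^ 2 - Real.sin (φ 1) ^ 2)
        + (1 - 2 * b) * b * (Real.cos (φ 0) + Real.cos (φ 1)) + b ^ 2)
      - (1 / 6 + (-(b * (1 - 2 * b) / 4) * φ 0 ^ 2 + 0 * (φ 0 * φ 1)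
        + -(b * (1 - 2 * b) / 4) * φ 1 ^ 2))) =O[𝓝 0] fun φ => ‖φ‖ ^ 4 :=
    ((((hss 0).add (hss 1)).const_mul_left (-(b * (1 - 2 * b) ^ 2 / 4))).add
      (((hc 0).add (hc 1)).const_mul_left (b ^ 2 * (1 - 2 * b)))).congr_left fun φ => by ring
  have lin : ∀ p q : ℝ, _ := isBigO_linear (hφ 0) (hφ 1)
  have quad : ∀ p q s : ℝ, _ := isBigO_quadratic (hφ 0) (hφ 1)
  have cub : ∀ p q s t : ℝ, _ := isBigO_cubic (hφ 0) (hφ 1)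
  have main0 := isBigO_sub_of_perturbed_system hr0 (κ := 1 / 6) (k0 := -b ^ 2 / 2)
    (w0 := b ^ 2 * (3 - 2 * b)) (p0 := b ^ 2) (q0 := -(b ^ 2 / 2) + b ^ 3 / 3)
    (by norm_num) (fun φ => (H φ 0).1) (fun φ => (H φ 0).2.1)
    (fun φ => (H φ 0).2.2) h00 h01 h02 h11 h12 h22
    (b1 := fun φ => b ^ 2 * φ 0) (b3 := fun φ => -(b ^ 2) / 6 * φ 0 ^ 3)
    (p2 := fun φ => -(b ^ 2) / 2 * φ 0 ^ 2)
    (q2 := fun φ => (1 - 2 * b) * b ^ 2 / 4 * φ 0 ^ 2)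
    (((hs 0).const_mul_left (b ^ 2)).congr_left fun φ => by simp; ring)
    (((hc 0).const_mul_left (b ^ 2)).congr_left fun φ => by simp; ring)
    (((hc 0).const_mul_left (-((1 - 2 * b) * b ^ 2 / 2))).congr_left fun φ => by simp; ring)
    (quad _ _ _) (lin _ _) (cub _ _ _ _) (lin _ _) (cub _ _ _ _) (quad _ _ _) (quad _ _ _)
    (quad _ _ _)
    (lin (swimmerCoeffs 1 (1 - 2 * b)).x10 (swimmerCoeffs 1 (1 - 2 * b)).x01)
    (cub (swimmerCoeffs 1 (1 - 2 * b)).x30 (swimmerCoeffs 1 (1 - 2 * b)).x21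
      (swimmerCoeffs 1 (1 - 2 * b)).x12 (swimmerCoeffs 1 (1 - 2 * b)).x03)
    (quad (swimmerCoeffs 1 (1 - 2 * b)).y20 (swimmerCoeffs 1 (1 - 2 * b)).y11
      (swimmerCoeffs 1 (1 - 2 * b)).y02)
    (quad (swimmerCoeffs 1 (1 - 2 * b)).w20 (swimmerCoeffs 1 (1 - 2 * b)).w11
      (swimmerCoeffs 1 (1 - 2 * b)).w02)
    (fun φ => by simp only [swimmerCoeffs]; ring)
    (fun φ => by simp only [swimmerCoeffs]; ring)
    (by ring)
    (fun φ => by simp only [swimmerCoeffs]; ring)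
    (by ring)
    (fun φ => by simp only [swimmerCoeffs]; ring)
    ((hO 0 0).const_mul_left _) ((hO 1 0).const_mul_left _) (hO 2 0)
  have main1 := isBigO_sub_of_perturbed_system hr0 (κ := 1 / 6) (k0 := -b ^ 2 / 2)
    (w0 := -(b ^ 2 * (3 - 2 * b))) (p0 := b ^ 2) (q0 := b ^ 2 / 2 - b ^ 3 / 3)
    (by norm_num) (fun φ => (H φ 1).1) (fun φ => (H φ 1).2.1)
    (fun φ => (H φ 1).2.2) h00 h01 h02 h11 h12 h22
    (b1 := fun φ => -(b ^ 2) * φ 1) (b3 := fun φ => b ^ 2 / 6 * φ 1 ^ 3)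
    (p2 := fun φ => -(b ^ 2) / 2 * φ 1 ^ 2)
    (q2 := fun φ => -((1 - 2 * b) * b ^ 2) / 4 * φ 1 ^ 2)
    (((hs 1).const_mul_left (-b ^ 2)).congr_left fun φ => by simp; ring)
    (((hc 1).const_mul_left (b ^ 2)).congr_left fun φ => by simp; ring)
    (((hc 1).const_mul_left ((1 - 2 * b) * b ^ 2 / 2)).congr_left fun φ => by simp; ring)
    (quad _ _ _) (lin _ _) (cub _ _ _ _) (lin _ _) (cub _ _ _ _) (quad _ _ _) (quad _ _ _)
    (quad _ _ _)
    (lin (-(swimmerCoeffs 1 (1 - 2 * b)).x01) (-(swimmerCoeffs 1 (1 - 2 * b)).x10))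
    (cub (-(swimmerCoeffs 1 (1 - 2 * b)).x03) (-(swimmerCoeffs 1 (1 - 2 * b)).x12)
      (-(swimmerCoeffs 1 (1 - 2 * b)).x21) (-(swimmerCoeffs 1 (1 - 2 * b)).x30))
    (quad (swimmerCoeffs 1 (1 - 2 * b)).y02 (swimmerCoeffs 1 (1 - 2 * b)).y11
      (swimmerCoeffs 1 (1 - 2 * b)).y20)
    (quad (-(swimmerCoeffs 1 (1 - 2 * b)).w02) (-(swimmerCoeffs 1 (1 - 2 * b)).w11)
      (-(swimmerCoeffs 1 (1 - 2 * b)).w20))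
    (fun φ => by simp only [swimmerCoeffs]; ring)
    (fun φ => by simp only [swimmerCoeffs]; ring)
    (by ring)
    (fun φ => by simp only [swimmerCoeffs]; ring)
    (by ring)
    (fun φ => by simp only [swimmerCoeffs]; ring)
    ((hO 0 1).const_mul_left _) ((hO 1 1).const_mul_left _) (hO 2 1)
  constructor
  · refine (main0.1.const_mul_left l).congr_left fun φ => ?_
    rw [mul_sub, ← hdiv]
    simp only [VelocityCoeffs.x1, VelocityCoeffs.x3, swimmerCoeffs]
    ring
  · refine (main1.1.const_mul_left l).congr_left fun φ => ?_
    rw [mul_sub, ← hdiv]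
    simp only [VelocityCoeffs.x1, VelocityCoeffs.x3, swimmerCoeffs]
    ring
  · refine (main0.2.1.const_mul_left l).congr_left fun φ => ?_
    rw [mul_sub, ← hdiv]
    simp only [VelocityCoeffs.y2, swimmerCoeffs]
    ring
  · refine (main1.2.1.const_mul_left l).congr_left fun φ => ?_
    rw [mul_sub, ← hdiv]
    simp only [VelocityCoeffs.y2, swimmerCoeffs]
    ring
  · refine main0.2.2.congr_left fun φ => ?_
    simp only [VelocityCoeffs.w2, swimmerCoeffs]
    ring
  · refine main1.2.2.congr_left fun φ => ?_
    simp only [VelocityCoeffs.w2, swimmerCoeffs]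
    ring

/-! ### Estimates for small amplitudes, uniform in time -/

section Orders

variable {α : Type*} {F : Filter α} {r : α → ℝ}

/-- Expansion of the laboratory velocity `cos θ · g - sin θ · k` in a small parameter `r`, from
those of the body velocities `g`, `k` and of the orientation `θ`. -/
theorem isBigO_rotated_velocity (hr0 : Tendsto r F (𝓝 0)) {θ g k θ1 θ3 g1 g3 k0 k2 : α → ℝ}
    (hθ : (fun x => θ x - (r x * θ1 x + r x ^ 3 * θ3 x)) =O[F] fun x => r x ^ 5)
    (hg : (fun x => g x - (r x * g1 x + r x ^ 3 * g3 x)) =O[F] fun x => r x ^ 5)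
    (hk : (fun x => k x - (k0 x + r x ^ 2 * k2 x)) =O[F] fun x => r x ^ 4)
    (hθ1 : θ1 =O[F] fun _ => (1 : ℝ)) (hθ3 : θ3 =O[F] fun _ => (1 : ℝ))
    (hg1 : g1 =O[F] fun _ => (1 : ℝ)) (hg3 : g3 =O[F] fun _ => (1 : ℝ))
    (hk0 : k0 =O[F] fun _ => (1 : ℝ)) (hk2 : k2 =O[F] fun _ => (1 : ℝ)) :
    (fun x => Real.cos (θ x) * g x - Real.sin (θ x) * k x
      - (r x * (g1 x - θ1 x * k0 x) + r x ^ 3 * (g3 x - g1 x * θ1 x ^ 2 / 2 - θ1 x * k2 x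
        - θ3 x * k0 x + θ1 x ^ 3 * k0 x / 6))) =O[F] fun x => r x ^ 5 := by
  have hr : r =O[F] fun _ => (1 : ℝ) := hr0.isBigO_one ℝ
  have lo : ∀ {m : ℕ} (n : ℕ) {f : α → ℝ}, (f =O[F] fun x => r x ^ m) → n ≤ m →
      f =O[F] fun x => r x ^ n := fun n f hf h => isBigO_pow_mono hr h hf
  have rp : ∀ n : ℕ, (fun x => r x ^ n) =O[F] fun x => r x ^ n := fun n => isBigO_refl _ _
  have b : ∀ {f : α → ℝ}, (f =O[F] fun _ => (1 : ℝ)) → f =O[F] fun x => r x ^ 0 := by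
    intro f hf
    simpa using hf
  have m1 : (fun x => r x * θ1 x) =O[F] fun x => r x ^ 1 := by
    simpa using isBigO_pow_mul hr (rp 1) (b hθ1) (k := 1)
  have m3 : (fun x => r x ^ 3 * θ3 x) =O[F] fun x => r x ^ 3 := isBigO_pow_mul hr (rp 3) (b hθ3)
  have d3 : (fun x => θ x - r x * θ1 x) =O[F] fun x => r x ^ 3 :=
    ((lo 3 hθ (by norm_num)).add m3).congr_left fun x => by ring
  have t1 : θ =O[F] fun x => r x ^ 1 :=
    ((lo 1 d3 (by norm_num)).add m1).congr_left fun x => by ring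
  have t1' : θ =O[F] r := by simpa using t1
  have cube : (fun x => θ x ^ 3 - (r x * θ1 x) ^ 3) =O[F] fun x => r x ^ 5 := by
    refine (isBigO_pow_mul hr d3 (((isBigO_pow_mul hr t1 t1 (k := 2)).add
      (isBigO_pow_mul hr t1 m1 (k := 2))).add (isBigO_pow_mul hr m1 m1 (k := 2)))).congr_left
      fun x => ?_
    ring
  have square : (fun x => θ x ^ 2 - (r x * θ1 x) ^ 2) =O[F] fun x => r x ^ 4 := by
    refine (isBigO_pow_mul hr d3 (t1.add m1)).congr_left fun x => ?_
    ring
  have hsin : (fun x => Real.sin (θ x) - (r x * θ1 x + r x ^ 3 * (θ3 x - θ1 x ^ 3 / 6)))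
      =O[F] fun x => r x ^ 5 := by
    refine (((isBigO_sin_comp hr0 t1').add hθ).sub (cube.const_mul_left (1 / 6))).congr_left
      fun x => ?_
    ring
  have hcos : (fun x => Real.cos (θ x) - (1 - r x ^ 2 * θ1 x ^ 2 / 2)) =O[F] fun x => r x ^ 4 := by
    refine ((isBigO_cos_comp hr0 t1').sub (square.const_mul_left (1 / 2))).congr_left fun x => ?_
    ring
  have hσ : (fun x => θ3 x - θ1 x ^ 3 / 6) =O[F] fun x => r x ^ 0 := by
    refine (b hθ3).sub ?_
    have := (hθ1.pow 3).const_mul_left (1 / 6)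
    simp only [one_pow] at this
    exact (b this).congr_left fun x => by ring
  have hθ1sq : (fun x => θ1 x ^ 2 / 2) =O[F] fun x => r x ^ 0 := by
    have := (hθ1.pow 2).const_mul_left (1 / 2)
    simp only [one_pow] at this
    exact (b this).congr_left fun x => by ring
  have n1 : (fun x => r x * g1 x) =O[F] fun x => r x ^ 1 := by
    simpa using isBigO_pow_mul hr (rp 1) (b hg1) (k := 1)
  have n3 : (fun x => r x ^ 3 * g3 x) =O[F] fun x => r x ^ 3 := isBigO_pow_mul hr (rp 3) (b hg3)
  have hg' : g =O[F] fun x => r x ^ 1 :=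
    (((lo 1 hg (by norm_num)).add n1).add (lo 1 n3 (by norm_num))).congr_left fun x => by ring
  have hk' : k =O[F] fun x => r x ^ 0 :=
    (((lo 0 hk (by norm_num)).add (b hk0)).add
      (isBigO_pow_mul hr (rp 2) (b hk2) (k := 0))).congr_left fun x => by ring
  have hC : (fun x => 1 - r x ^ 2 * θ1 x ^ 2 / 2) =O[F] fun x => r x ^ 0 :=
    ((isBigO_pow_zero_of_const 1).sub (isBigO_pow_mul hr (rp 2) hθ1sq (k := 0))).congr_left
      fun x => by ring
  have hS : (fun x => r x * θ1 x + r x ^ 3 * (θ3 x - θ1 x ^ 3 / 6)) =O[F] fun x => r x ^ 1 :=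
    m1.add (isBigO_pow_mul hr (rp 3) hσ)
  have l1 := isBigO_pow_mul hr (isBigO_pow_mul hr (rp 2) hθ1sq (k := 2)) n3 (k := 5)
  have l2 := isBigO_pow_mul hr (rp 5) (isBigO_pow_mul hr hσ (b hk2) (k := 0)) (k := 5)
  refine ((((((isBigO_pow_mul hr hcos hg').add (isBigO_pow_mul hr hC hg)).sub l1).sub
    (isBigO_pow_mul hr hsin hk')).sub (isBigO_pow_mul hr hS hk)).sub l2).congr_left fun x => ?_
  ring

end Orders

section Gait

/-- Small amplitudes, uniformly in time: the pairs `(ε, t)` with `ε → 0` and `t ∈ [0, T]`. -/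
def smallAmplitude (T : ℝ) : Filter (ℝ × ℝ) := 𝓝 0 ×ˢ 𝓟 (Icc 0 T)

theorem tendsto_fst_smallAmplitude (T : ℝ) :
    Tendsto (fun p : ℝ × ℝ => p.1) (smallAmplitude T) (𝓝 0) :=
  tendsto_fst

theorem isBigO_one_of_continuous {T : ℝ} {f : ℝ → ℝ} (hf : Continuous f) :
    (fun p : ℝ × ℝ => f p.2) =O[smallAmplitude T] fun _ => (1 : ℝ) := by
  obtain ⟨M, hM⟩ := isCompact_Icc.exists_bound_of_continuousOn (hf.continuousOn (s := Icc 0 T))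
  refine IsBigO.of_bound M ?_
  rw [smallAmplitude, eventually_prod_principal_iff]
  exact Eventually.of_forall fun ε t ht => by simpa using hM t ht

theorem isBigO_integral {T : ℝ} {n : ℕ} {g : ℝ → ℝ → ℝ}
    (hg : (fun p : ℝ × ℝ => g p.1 p.2) =O[smallAmplitude T] fun p => p.1 ^ n) :
    (fun p : ℝ × ℝ => ∫ τ in (0 : ℝ)..p.2, g p.1 τ) =O[smallAmplitude T] fun p => p.1 ^ n := by
  obtain ⟨C, hC⟩ := hg.bound
  refine IsBigO.of_bound (C * T) ?_
  rw [smallAmplitude, eventually_prod_principal_iff] at hC ⊢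
  filter_upwards [hC] with ε hε t ht
  have h0 : 0 ≤ C * ‖ε ^ n‖ := (norm_nonneg _).trans (hε 0 ⟨le_rfl, ht.1.trans ht.2⟩)
  have := intervalIntegral.norm_integral_le_of_norm_le_const (a := 0) (b := t)
    (f := fun τ => g ε τ) (C := C * ‖ε ^ n‖) (fun τ hτ => by
      rw [uIoc_of_le ht.1] at hτ
      exact hε τ ⟨hτ.1.le, hτ.2.trans ht.2⟩)
  refine this.trans ?_
  rw [sub_zero, abs_of_nonneg ht.1, mul_right_comm]
  simpa [mul_right_comm] using mul_le_mul_of_nonneg_left ht.2 h0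

theorem isBigO_amplitude_slice {T : ℝ} (hT : 0 ≤ T) {n : ℕ} {g : ℝ → ℝ → ℝ}
    (hg : (fun p : ℝ × ℝ => g p.1 p.2) =O[smallAmplitude T] fun p => p.1 ^ n) :
    (fun ε => g ε T) =O[𝓝 0] fun ε => ε ^ n := by
  have h : Tendsto (fun ε : ℝ => (ε, T)) (𝓝 0) (smallAmplitude T) :=
    tendsto_id.prodMk (tendsto_principal.mpr (Eventually.of_forall fun _ => ⟨hT, le_rfl⟩))
  exact hg.comp_tendsto h

variable {s D : ℝ → Fin 2 → ℝ} {N : Set ℝ} {T : ℝ}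

/-- An estimate near the straight shape, evaluated along the scaled gait `ε s(t)`. -/
theorem IsShapePath.isBigO_comp_smul (h : IsShapePath s D N) {n : ℕ} {f : (Fin 2 → ℝ) → ℝ}
    (hf : f =O[𝓝 0] fun φ => ‖φ‖ ^ n) :
    (fun p : ℝ × ℝ => f (p.1 • s p.2)) =O[smallAmplitude T] fun p => p.1 ^ n := by
  have hs : (fun p : ℝ × ℝ => ‖p.1 • s p.2‖) =O[smallAmplitude T] fun p => p.1 := by
    have := (isBigO_refl (fun p : ℝ × ℝ => p.1) (smallAmplitude T)).norm_left.mul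
      (isBigO_one_of_continuous h.continuous.norm)
    simpa [norm_smul] using this
  have ht : Tendsto (fun p : ℝ × ℝ => p.1 • s p.2) (smallAmplitude T) (𝓝 0) :=
    tendsto_zero_iff_norm_tendsto_zero.mpr
      (hs.trans_tendsto (tendsto_fst_smallAmplitude T))
  exact (hf.comp_tendsto ht).trans (hs.pow n)

theorem IsShapePath.isBigO_velocity (h : IsShapePath s D N) (j : Fin 2) :
    (fun p : ℝ × ℝ => D p.2 j) =O[smallAmplitude T] fun p => p.1 ^ 0 := by
  obtain ⟨M, hM⟩ := h.bounded
  exact IsBigO.of_bound M (Eventually.of_forall fun p => by simpa using hM p.2 j)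

/-- If the coefficients of a one-form are of order `n` in the amplitude, then its integral along the
scaled gait, whose velocity is `ε D`, is of order `n + 1`. -/
theorem IsShapePath.isBigO_integral_pullback (h : IsShapePath s D N) {n m : ℕ} (hm : m = n + 1)
    {c : ℝ → ℝ → Fin 2 → ℝ}
    (hc : ∀ j, (fun p : ℝ × ℝ => c p.1 p.2 j) =O[smallAmplitude T] fun p => p.1 ^ n) :
    (fun p : ℝ × ℝ => ∫ τ in (0 : ℝ)..p.2, p.1 * pullback (c p.1) D τ) =O[smallAmplitude T]
      fun p => p.1 ^ m := by
  subst hm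
  have hr := (tendsto_fst_smallAmplitude T).isBigO_one ℝ
  have := ((isBigO_pow_mul hr (hc 0) (h.isBigO_velocity 0) (k := n) le_rfl).add
    (isBigO_pow_mul hr (hc 1) (h.isBigO_velocity 1) (k := n) le_rfl))
  refine isBigO_integral (g := fun ε τ => ε * pullback (c ε) D τ) ?_
  exact ((isBigO_refl (fun p : ℝ × ℝ => p.1) _).mul this).congr_right fun p => by ring

end Gait

/-! ### Expansion of the orientation and of the net displacement -/

section Expansion

/-- The part of the orientation that is linear in the amplitude, for a gait that starts with equal
joint angles. -/
def heading1 (c : VelocityCoeffs) (s : ℝ → Fin 2 → ℝ) (t : ℝ) : ℝ := c.w00 * (s t 0 - s t 1)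

/-- The integral of `u v (du - dv)` along the gait up to time `t`, the path-dependent contribution
to the cubic part of the orientation. -/
noncomputable def pathMoment (s D : ℝ → Fin 2 → ℝ) (t : ℝ) : ℝ :=
  ∫ τ in (0 : ℝ)..t, pullback (fun τ => ![s τ 0 * s τ 1, -(s τ 0 * s τ 1)]) D τ

/-- The part of the orientation that is cubic in the amplitude, for a gait that starts with equal
joint angles. -/
noncomputable def heading3 (c : VelocityCoeffs) (s D : ℝ → Fin 2 → ℝ) (t : ℝ) : ℝ :=
  c.w20 / 3 * (s t 0 ^ 3 - s t 1 ^ 3) + c.w02 * (s t 0 * s t 1 ^ 2 - s t 0 ^ 2 * s t 1)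
    + (c.w11 + 2 * c.w02) * pathMoment s D t

/-- The one-form whose integral is the coefficient of `ε²` in the net displacement. -/
def form2 (c : VelocityCoeffs) (s : ℝ → Fin 2 → ℝ) (t : ℝ) : Fin 2 → ℝ :=
  ![c.x1 (s t 0) (s t 1) - heading1 c s t * c.y00,
    -c.x1 (s t 1) (s t 0) - heading1 c s t * c.y00]

/-- The one-form whose integral is the coefficient of `ε⁴` in the net displacement. -/
noncomputable def form4 (c : VelocityCoeffs) (s D : ℝ → Fin 2 → ℝ) (t : ℝ) : Fin 2 → ℝ :=
  ![c.x3 (s t 0) (s t 1) - c.x1 (s t 0) (s t 1) * heading1 c s t ^ 2 / 2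
      - heading1 c s t * c.y2 (s t 0) (s t 1) - heading3 c s D t * c.y00
      + heading1 c s t ^ 3 * c.y00 / 6,
    -c.x3 (s t 1) (s t 0) - -c.x1 (s t 1) (s t 0) * heading1 c s t ^ 2 / 2
      - heading1 c s t * c.y2 (s t 1) (s t 0) - heading3 c s D t * c.y00
      + heading1 c s t ^ 3 * c.y00 / 6]

variable {s D : ℝ → Fin 2 → ℝ} {N : Set ℝ} {T : ℝ} {ct : ℝ} {L : Fin 3 → ℝ} {c : VelocityCoeffs}

section Continuity

theorem continuous_pathMomentForm (h : IsShapePath s D N) (j : Fin 2) :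
    Continuous fun t => ![s t 0 * s t 1, -(s t 0 * s t 1)] j := by
  have h0 := h.continuous_apply 0
  have h1 := h.continuous_apply 1
  fin_cases j <;> simp <;> fun_prop

theorem continuous_pathMoment (h : IsShapePath s D N) : Continuous (pathMoment s D) :=
  h.continuous_integral_pullback (continuous_pathMomentForm h)

theorem continuous_heading1 (h : IsShapePath s D N) : Continuous (heading1 c s) := by
  have h0 := h.continuous_apply 0
  have h1 := h.continuous_apply 1
  unfold heading1
  fun_prop

theorem continuous_heading3 (h : IsShapePath s D N) : Continuous (heading3 c s D) := by
  have h0 := h.continuous_apply 0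
  have h1 := h.continuous_apply 1
  have h2 := continuous_pathMoment h
  unfold heading3
  fun_prop

theorem continuous_form2 (h : IsShapePath s D N) (j : Fin 2) :
    Continuous fun t => form2 c s t j := by
  have h0 := h.continuous_apply 0
  have h1 := h.continuous_apply 1
  have h2 := continuous_heading1 (c := c) h
  fin_cases j <;> simp [form2, VelocityCoeffs.x1] <;> fun_prop

theorem continuous_form4 (h : IsShapePath s D N) (j : Fin 2) :
    Continuous fun t => form4 c s D t j := by
  have h0 := h.continuous_apply 0
  have h1 := h.continuous_apply 1
  have h2 := continuous_heading1 (c := c) h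
  have h3 := continuous_heading3 (c := c) h
  fin_cases j <;>
    simp [form4, VelocityCoeffs.x1, VelocityCoeffs.x3, VelocityCoeffs.y2] <;> fun_prop

end Continuity

theorem pullback_smul_velocity (c D : ℝ → Fin 2 → ℝ) (ε t : ℝ) :
    pullback c (fun t => ε • D t) t = ε * pullback c D t := by
  simp [pullback]
  ring

theorem integral_headingForm1 (h : IsShapePath s D N) (hs : s 0 0 = s 0 1) {t : ℝ} (ht : 0 ≤ t) :
    ∫ τ in (0 : ℝ)..t, pullback (fun _ => ![c.w00, -c.w00]) D τ = heading1 c s t := by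
  rw [h.integral_pullback_eq_sub (c := fun _ => ![c.w00, -c.w00]) (fun j => continuous_const)
    h.finite ht
    (f := heading1 c s) (continuous_heading1 h).continuousOn]
  · simp [heading1, hs]
  · intro τ _ hτ
    refine (((h.hasDerivAt_apply hτ 0).sub (h.hasDerivAt_apply hτ 1)).const_mul c.w00).congr_deriv
      ?_
    simp [pullback]
    ring

theorem continuous_headingForm3 (h : IsShapePath s D N) (j : Fin 2) :
    Continuous fun t => ![c.w2 (s t 0) (s t 1), -c.w2 (s t 1) (s t 0)] j := by
  have h0 := h.continuous_apply 0
  have h1 := h.continuous_apply 1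
  fin_cases j <;> simp [VelocityCoeffs.w2] <;> fun_prop

theorem integral_headingForm3 (h : IsShapePath s D N) (hs : s 0 0 = s 0 1) {t : ℝ} (ht : 0 ≤ t) :
    ∫ τ in (0 : ℝ)..t, pullback (fun τ => ![c.w2 (s τ 0) (s τ 1), -c.w2 (s τ 1) (s τ 0)]) D τ
      = heading3 c s D t := by
  rw [h.integral_pullback_eq_sub (continuous_headingForm3 h) h.finite ht
    (f := heading3 c s D) (continuous_heading3 h).continuousOn]
  · simp only [heading3, pathMoment, hs, intervalIntegral.integral_same]
    ring
  · intro τ _ hτ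
    have hu := h.hasDerivAt_apply hτ 0
    have hv := h.hasDerivAt_apply hτ 1
    have hm : HasDerivAt (pathMoment s D) _ τ :=
      h.hasDerivAt_integral_pullback (continuous_pathMomentForm h) hτ
    refine ((((hu.pow 3).sub (hv.pow 3)).const_mul (c.w20 / 3)).add
      (((hu.mul (hv.pow 2)).sub ((hu.pow 2).mul hv)).const_mul c.w02) |>.add
      (hm.const_mul (c.w11 + 2 * c.w02))).congr_deriv ?_
    simp [pullback, VelocityCoeffs.w2]
    ring

theorem isBigO_heading (hct : 0 < ct) (hL : ∀ i, 0 < L i) (h : IsShapePath s D N)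
    (hs : s 0 0 = s 0 1) (hG : HasVelocityExpansion (dynMatrix ct L 0) c) :
    (fun p : ℝ × ℝ => heading ct L (fun t => p.1 • s t) (fun t => p.1 • D t) p.2
      - (p.1 * heading1 c s p.2 + p.1 ^ 3 * heading3 c s D p.2))
      =O[smallAmplitude T] fun p => p.1 ^ 5 := by
  have key := h.isBigO_integral_pullback (T := T) (n := 4) (m := 5) rfl
    (c := fun ε τ => dynMatrix ct L 0 (ε • s τ) 2 - (![c.w00, -c.w00]
      + ε ^ 2 • ![c.w2 (s τ 0) (s τ 1), -c.w2 (s τ 1) (s τ 0)])) fun j => ?_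
  · refine key.congr' ?_ EventuallyEq.rfl
    rw [EventuallyEq, smallAmplitude, eventually_prod_principal_iff]
    refine Eventually.of_forall fun ε t ht => ?_
    simp only
    have hε := h.const_smul ε
    have i0 := hε.intervalIntegrable_pullback (continuous_dynMatrix_path hct hL hε 2) 0 t
    have i1 := (h.intervalIntegrable_pullback (c := fun _ => ![c.w00, -c.w00])
      (fun j => continuous_const) 0 t).const_mul ε
    have i3 := (h.intervalIntegrable_pullback (continuous_headingForm3 (c := c) h)
      0 t).const_mul (ε ^ 3)
    rw [heading, ← integral_headingForm1 h hs ht.1, ← integral_headingForm3 h hs ht.1,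
      ← intervalIntegral.integral_const_mul, ← intervalIntegral.integral_const_mul,
      ← intervalIntegral.integral_add i1 i3, ← intervalIntegral.integral_sub i0 (i1.add i3)]
    refine intervalIntegral.integral_congr fun τ _ => ?_
    simp only [pullback_smul_velocity]
    simp [pullback]
    ring
  · fin_cases j
    · refine (h.isBigO_comp_smul hG.w_fst).congr_left fun p => ?_
      simp [VelocityCoeffs.w2]
      ring
    · refine (h.isBigO_comp_smul hG.w_snd).congr_left fun p => ?_
      simp [VelocityCoeffs.w2]
      ring

/-- The net displacement to fourth order in the amplitude, as integrals over the gait. -/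
theorem isBigO_displacement (hct : 0 < ct) (hL : ∀ i, 0 < L i) (h : IsShapePath s D N)
    (hT : 0 ≤ T) (hs : s 0 0 = s 0 1) (hG : HasVelocityExpansion (dynMatrix ct L 0) c) :
    (fun ε : ℝ => (∫ t in (0 : ℝ)..T, pullback
        (velocityForm ct L (fun t => ε • s t) (fun t => ε • D t) 0) (fun t => ε • D t) t)
      - ((∫ t in (0 : ℝ)..T, pullback (form2 c s) D t) * ε ^ 2
        + (∫ t in (0 : ℝ)..T, pullback (form4 c s D) D t) * ε ^ 4))
      =O[𝓝 0] fun ε => ε ^ 6 := by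
  have key := h.isBigO_integral_pullback (T := T) (n := 5) (m := 6) rfl (c := fun ε τ =>
      velocityForm ct L (fun t => ε • s t) (fun t => ε • D t) 0 τ
        - (ε • form2 c s τ + ε ^ 3 • form4 c s D τ)) fun j => ?_
  · refine (isBigO_amplitude_slice hT (g := fun ε t => ∫ τ in (0 : ℝ)..t, ε * pullback (fun τ =>
      velocityForm ct L (fun t => ε • s t) (fun t => ε • D t) 0 τ
        - (ε • form2 c s τ + ε ^ 3 • form4 c s D τ)) D τ) key).congr_left fun ε => ?_
    have hε := h.const_smul ε
    have i0 := hε.intervalIntegrable_pullback (continuous_velocityForm hct hL hε 0) 0 T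
    have i2 := (h.intervalIntegrable_pullback (continuous_form2 (c := c) h) 0 T).mul_const (ε ^ 2)
    have i4 := (h.intervalIntegrable_pullback (continuous_form4 (c := c) h) 0 T).mul_const (ε ^ 4)
    rw [← intervalIntegral.integral_mul_const, ← intervalIntegral.integral_mul_const,
      ← intervalIntegral.integral_add i2 i4, ← intervalIntegral.integral_sub i0 (i2.add i4)]
    refine intervalIntegral.integral_congr fun τ _ => ?_
    simp only [pullback_smul_velocity]
    simp [pullback]
    ring
  · have hr := tendsto_fst_smallAmplitude T
    have hθ := isBigO_heading (T := T) hct hL h hs hG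
    have h0 := h.continuous_apply 0
    have h1 := h.continuous_apply 1
    have hθ1 := isBigO_one_of_continuous (T := T) (continuous_heading1 (c := c) h)
    have hθ3 := isBigO_one_of_continuous (T := T) (continuous_heading3 (c := c) h)
    have hk0 := isBigO_one_of_continuous (T := T) (f := fun _ => c.y00) continuous_const
    fin_cases j
    · refine (isBigO_rotated_velocity hr hθ
        (g := fun p => dynMatrix ct L 0 (p.1 • s p.2) 0 0)
        (k := fun p => dynMatrix ct L 0 (p.1 • s p.2) 1 0)
        (g1 := fun p => c.x1 (s p.2 0) (s p.2 1)) (g3 := fun p => c.x3 (s p.2 0) (s p.2 1))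
        (k2 := fun p => c.y2 (s p.2 0) (s p.2 1))
        ?_ ?_ hθ1 hθ3 (isBigO_one_of_continuous (f := fun t => c.x1 (s t 0) (s t 1)) ?_)
        (isBigO_one_of_continuous (f := fun t => c.x3 (s t 0) (s t 1)) ?_) hk0
        (isBigO_one_of_continuous (f := fun t => c.y2 (s t 0) (s t 1)) ?_)).congr_left
        fun p => ?_
      · refine (h.isBigO_comp_smul hG.x_fst).congr_left fun p => ?_
        simp [VelocityCoeffs.x1, VelocityCoeffs.x3]
        ring
      · refine (h.isBigO_comp_smul hG.y_fst).congr_left fun p => ?_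
        simp [VelocityCoeffs.y2]
        ring
      · unfold VelocityCoeffs.x1; fun_prop
      · unfold VelocityCoeffs.x3; fun_prop
      · unfold VelocityCoeffs.y2; fun_prop
      · simp [velocityForm_zero, form2, form4]
    · refine (isBigO_rotated_velocity hr hθ
        (g := fun p => dynMatrix ct L 0 (p.1 • s p.2) 0 1)
        (k := fun p => dynMatrix ct L 0 (p.1 • s p.2) 1 1)
        (g1 := fun p => -c.x1 (s p.2 1) (s p.2 0)) (g3 := fun p => -c.x3 (s p.2 1) (s p.2 0))
        (k2 := fun p => c.y2 (s p.2 1) (s p.2 0))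
        ?_ ?_ hθ1 hθ3 (isBigO_one_of_continuous (f := fun t => -c.x1 (s t 1) (s t 0)) ?_)
        (isBigO_one_of_continuous (f := fun t => -c.x3 (s t 1) (s t 0)) ?_) hk0
        (isBigO_one_of_continuous (f := fun t => c.y2 (s t 1) (s t 0)) ?_)).congr_left
        fun p => ?_
      · refine (h.isBigO_comp_smul hG.x_snd).congr_left fun p => ?_
        simp [VelocityCoeffs.x1, VelocityCoeffs.x3]
        ring
      · refine (h.isBigO_comp_smul hG.y_snd).congr_left fun p => ?_
        simp [VelocityCoeffs.y2]
        ring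
      · unfold VelocityCoeffs.x1; fun_prop
      · unfold VelocityCoeffs.x3; fun_prop
      · unfold VelocityCoeffs.y2; fun_prop
      · simp [velocityForm_zero, form2, form4]

end Expansion

/-! ### Reduction to moments of the gait -/

section Moments

variable {s D : ℝ → Fin 2 → ℝ} {N : Set ℝ} {T : ℝ} {c : VelocityCoeffs}

/-- The moment `∫ uᵐ vⁿ du` of a gait; for a closed gait it is, by Green's theorem, up to a factor
the integral of `uᵐ vⁿ⁻¹` over the enclosed region. -/
noncomputable def moment (s D : ℝ → Fin 2 → ℝ) (T : ℝ) (m n : ℕ) : ℝ :=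
  ∫ t in (0 : ℝ)..T, pullback (fun t => ![s t 0 ^ m * s t 1 ^ n, 0]) D t

theorem continuous_momentForm (h : IsShapePath s D N) (m n : ℕ) (j : Fin 2) :
    Continuous fun t => ![s t 0 ^ m * s t 1 ^ n, 0] j := by
  have h0 := h.continuous_apply 0
  have h1 := h.continuous_apply 1
  fin_cases j <;> simp <;> fun_prop

/-- The coefficient of `ε²` depends on the closed gait only through the enclosed area. -/
theorem integral_form2 (h : IsShapePath s D N) (hT : 0 ≤ T) (hclosed : s T = s 0) :
    ∫ t in (0 : ℝ)..T, pullback (form2 c s) D t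
      = 2 * (c.x01 + c.w00 * c.y00) * moment s D T 0 1 := by
  have iM := (h.intervalIntegrable_pullback (continuous_momentForm h 0 1) 0 T).const_mul
    (2 * (c.x01 + c.w00 * c.y00))
  have iF := h.intervalIntegrable_pullback (continuous_form2 (c := c) h) 0 T
  have h0 := h.continuous_apply 0
  have h1 := h.continuous_apply 1
  -- The difference of the two one-forms is exact.
  have key := h.integral_pullback_eq_sub (c := fun t => form2 c s t
      - (2 * (c.x01 + c.w00 * c.y00)) • ![s t 0 ^ 0 * s t 1 ^ 1, 0])
    (fun j => (continuous_form2 h j).sub ((continuous_momentForm h 0 1 j).const_smul _)) h.finite hT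
    (f := fun t => (c.x10 - c.w00 * c.y00) / 2 * s t 0 ^ 2
      + (-c.x01 - c.w00 * c.y00) * (s t 0 * s t 1)
      + (-c.x10 + c.w00 * c.y00) / 2 * s t 1 ^ 2)
    (Continuous.continuousOn (by fun_prop)) ?_
  · rw [moment, ← intervalIntegral.integral_const_mul, ← sub_eq_zero,
      ← intervalIntegral.integral_sub iF iM]
    simp only [hclosed, sub_self] at key
    refine Eq.trans (intervalIntegral.integral_congr fun t _ => ?_) key
    simp [pullback]
    ring
  · intro t _ ht
    have hu := h.hasDerivAt_apply ht 0
    have hv := h.hasDerivAt_apply ht 1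
    refine ((((hu.pow 2).const_mul ((c.x10 - c.w00 * c.y00) / 2)).add
      ((hu.mul hv).const_mul (-c.x01 - c.w00 * c.y00))).add
      ((hv.pow 2).const_mul ((-c.x10 + c.w00 * c.y00) / 2))).congr_deriv ?_
    simp [pullback, form2, heading1, VelocityCoeffs.x1]
    ring

/-- The coefficient of `ε⁴` is a combination of three moments of the closed gait.  After the
contribution of `pathMoment` to the orientation has been integrated by parts, `form4` is a one-form
`P du + Q dv` with cubic `P`, `Q`; `pᵢⱼ` and `qᵢⱼ` are their coefficients of `uⁱ vʲ`. -/
theorem integral_form4 (h : IsShapePath s D N) (hT : 0 ≤ T) (hclosed : s T = s 0)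
    (hm : pathMoment s D T = 0) {p30 p21 p12 p03 q30 q21 q12 q03 : ℝ}
    (hp30 : p30 = c.x30 - c.w00 ^ 2 / 2 * c.x10 - c.w00 * c.y20 - c.y00 * c.w20 / 3
      + c.w00 ^ 3 * c.y00 / 6)
    (hp21 : p21 = c.x21 + c.w00 ^ 2 / 2 * (2 * c.x10 - c.x01) + c.w00 * (c.y20 - c.y11)
      + c.y00 * c.w02 - c.w00 ^ 3 * c.y00 / 2 + (c.w11 + 2 * c.w02) * c.y00)
    (hp12 : p12 = c.x12 - c.w00 ^ 2 / 2 * (c.x10 - 2 * c.x01) - c.w00 * (c.y02 - c.y11)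
      - c.y00 * c.w02 + c.w00 ^ 3 * c.y00 / 2 + (c.w11 + 2 * c.w02) * c.y00)
    (hp03 : p03 = c.x03 - c.w00 ^ 2 / 2 * c.x01 + c.w00 * c.y02 + c.y00 * c.w20 / 3
      - c.w00 ^ 3 * c.y00 / 6)
    (hq30 : q30 = -c.x03 + c.w00 ^ 2 / 2 * c.x01 - c.w00 * c.y02 - c.y00 * c.w20 / 3
      + c.w00 ^ 3 * c.y00 / 6)
    (hq21 : q21 = -c.x12 + c.w00 ^ 2 / 2 * (c.x10 - 2 * c.x01) - c.w00 * (c.y11 - c.y02)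
      + c.y00 * c.w02 - c.w00 ^ 3 * c.y00 / 2 - (c.w11 + 2 * c.w02) * c.y00)
    (hq12 : q12 = -c.x21 + c.w00 ^ 2 / 2 * (c.x01 - 2 * c.x10) - c.w00 * (c.y20 - c.y11)
      - c.y00 * c.w02 + c.w00 ^ 3 * c.y00 / 2 - (c.w11 + 2 * c.w02) * c.y00)
    (hq03 : q03 = -c.x30 + c.w00 ^ 2 / 2 * c.x10 + c.w00 * c.y20 + c.y00 * c.w20 / 3
      - c.w00 ^ 3 * c.y00 / 6) :
    ∫ t in (0 : ℝ)..T, pullback (form4 c s D) D t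
      = (p21 - 3 * q30) * moment s D T 2 1 + (p12 - q21) * moment s D T 1 2
        + (p03 - q12 / 3) * moment s D T 0 3 := by
  have iM := fun m n (a : ℝ) =>
    (h.intervalIntegrable_pullback (continuous_momentForm h m n) 0 T).const_mul a
  have iF := h.intervalIntegrable_pullback (continuous_form4 (c := c) h) 0 T
  have h0 := h.continuous_apply 0
  have h1 := h.continuous_apply 1
  have h2 := continuous_pathMoment h
  -- The primitive is that of `Q` with respect to `v`, with the term in `u⁴` from `P`; the last
  -- summand is the boundary term of the integration by parts.
  have key := h.integral_pullback_eq_sub (c := fun t => form4 c s D t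
      - ((p21 - 3 * q30) • ![s t 0 ^ 2 * s t 1 ^ 1, 0] + (p12 - q21) • ![s t 0 ^ 1 * s t 1 ^ 2, 0]
        + (p03 - q12 / 3) • ![s t 0 ^ 0 * s t 1 ^ 3, 0]))
    (fun j => (continuous_form4 h j).sub ((((continuous_momentForm h 2 1 j).const_smul _).add
      ((continuous_momentForm h 1 2 j).const_smul _)).add
      ((continuous_momentForm h 0 3 j).const_smul _))) h.finite hT
    (f := fun t => p30 / 4 * s t 0 ^ 4 + q30 * (s t 0 ^ 3 * s t 1)
      + q21 / 2 * (s t 0 ^ 2 * s t 1 ^ 2) + q12 / 3 * (s t 0 * s t 1 ^ 3) + q03 / 4 * s t 1 ^ 4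
      + -((c.w11 + 2 * c.w02) * c.y00) * (pathMoment s D t * (s t 0 + s t 1)))
    (Continuous.continuousOn (by fun_prop)) ?_
  · have hm0 : pathMoment s D 0 = 0 := by simp [pathMoment]
    rw [moment, moment, moment, ← intervalIntegral.integral_const_mul,
      ← intervalIntegral.integral_const_mul, ← intervalIntegral.integral_const_mul,
      ← intervalIntegral.integral_add (iM _ _ _) (iM _ _ _),
      ← intervalIntegral.integral_add ((iM _ _ _).add (iM _ _ _)) (iM _ _ _), ← sub_eq_zero,
      ← intervalIntegral.integral_sub iF (((iM _ _ _).add (iM _ _ _)).add (iM _ _ _))]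
    simp only [hclosed, hm, hm0, sub_self] at key
    refine Eq.trans (intervalIntegral.integral_congr fun t _ => ?_) key
    simp [pullback]
    ring
  · intro t _ ht
    have hu := h.hasDerivAt_apply ht 0
    have hv := h.hasDerivAt_apply ht 1
    have hA : HasDerivAt (pathMoment s D) _ t :=
      h.hasDerivAt_integral_pullback (continuous_pathMomentForm h) ht
    refine (((((((hu.pow 4).const_mul (p30 / 4)).add (((hu.pow 3).mul hv).const_mul q30)).add
      (((hu.pow 2).mul (hv.pow 2)).const_mul (q21 / 2))).add
      ((hu.mul (hv.pow 3)).const_mul (q12 / 3))).add ((hv.pow 4).const_mul (q03 / 4))).add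
      ((hA.mul (hu.add hv)).const_mul (-((c.w11 + 2 * c.w02) * c.y00)))).congr_deriv ?_
    rw [hp30, hp21, hp12, hp03, hq30, hq21, hq12, hq03]
    simp [pullback, form4, heading1, heading3, VelocityCoeffs.x1, VelocityCoeffs.x3,
      VelocityCoeffs.y2]
    ring

/-- The net displacement of the symmetric swimmer for a closed gait that starts with equal joint
angles and whose fourth order moments are related as for a gait with a fourfold symmetry: up to
the order considered, it depends only on the moments `∮ v du` and `∮ u² v du`. -/
theorem isBigO_displacement_of_moments {ct l η : ℝ} (hct : 0 < ct) (hl : 0 < l) (hη : 0 < η)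
    (hη1 : η < 1) (h : IsShapePath s D N) (hT : 0 ≤ T) (hdiag : s 0 0 = s 0 1)
    (hclosed : s T = s 0) (hpath : pathMoment s D T = 0) (h12 : moment s D T 1 2 = 0)
    (h03 : moment s D T 0 3 = 3 * moment s D T 2 1) :
    (fun ε : ℝ => (∫ t in (0 : ℝ)..T, pullback
        (velocityForm ct ![η * l, (1 - η) / 2 * l, (1 - η) / 2 * l] (fun t => ε • s t)
          (fun t => ε • D t) 0) (fun t => ε • D t) t)
      - (f2 (moment s D T 0 1 / 16) l η * ε ^ 2 - f4 (moment s D T 2 1 / 256) l η * ε ^ 4))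
      =O[𝓝 0] fun ε => ε ^ 6 := by
  have hL : ∀ i, 0 < ![η * l, (1 - η) / 2 * l, (1 - η) / 2 * l] i := by
    have : 0 < (1 - η) / 2 := by linarith
    intro i
    fin_cases i <;> simp <;> positivity
  refine (isBigO_displacement hct hL h hT hdiag
    (hasVelocityExpansion_dynMatrix hct hl hη hη1)).congr_left fun ε => ?_
  rw [integral_form2 h hT hclosed, integral_form4 h hT hclosed hpath rfl rfl rfl rfl rfl rfl rfl
    rfl, h12, h03]
  simp only [swimmerCoeffs, f2, f4]
  ring

end Moments

/-! ### The circular and the square gait -/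

section Circle

/-- The velocity of the circular gait. -/
noncomputable def circularVelocity (t : ℝ) : Fin 2 → ℝ :=
  ![Real.cos (t + Real.pi / 4), -Real.sin (t + Real.pi / 4)]

theorem isShapePath_circularGait : IsShapePath circularGait circularVelocity ∅ where
  continuous := by
    refine continuous_pi fun j => ?_
    fin_cases j <;> simp [circularGait] <;> fun_prop
  measurable j := by
    fin_cases j <;> simp [circularVelocity] <;> fun_prop
  bounded := by
    refine ⟨1, fun t j => ?_⟩
    fin_cases j <;> simp [circularVelocity, Real.abs_cos_le_one, Real.abs_sin_le_one]
  finite := finite_empty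
  hasDerivAt t _ := by
    have h : HasDerivAt (fun t : ℝ => t + Real.pi / 4) 1 t := (hasDerivAt_id t).add_const _
    refine hasDerivAt_pi.mpr fun j => ?_
    fin_cases j
    · simpa [circularGait, circularVelocity] using h.sin
    · simpa [circularGait, circularVelocity] using h.cos
  continuousAt t _ := by
    refine Continuous.continuousAt (continuous_pi fun j => ?_)
    fin_cases j <;> simp [circularVelocity] <;> fun_prop

theorem sin_circular_end : Real.sin (2 * Real.pi + Real.pi / 4) = Real.sin (Real.pi / 4) := by
  rw [add_comm, Real.sin_add_two_pi]

theorem cos_circular_end : Real.cos (2 * Real.pi + Real.pi / 4) = Real.cos (Real.pi / 4) := by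
  rw [add_comm, Real.cos_add_two_pi]

/-- The integral along the circular gait of a one-form with primitive
`a t + g (sin τ) (cos τ)`, `τ = t + π / 4`. -/
theorem integral_circularGait {c : ℝ → Fin 2 → ℝ} (hc : ∀ j, Continuous fun t => c t j)
    (a : ℝ) {g : ℝ → ℝ → ℝ}
    (hg : ∀ t, HasDerivAt (fun t => a * t + g (Real.sin (t + Real.pi / 4))
      (Real.cos (t + Real.pi / 4))) (pullback c circularVelocity t) t) :
    ∫ t in (0 : ℝ)..2 * Real.pi, pullback c circularVelocity t = a * (2 * Real.pi) := by
  rw [isShapePath_circularGait.integral_pullback_eq_sub hc finite_empty Real.two_pi_pos.le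
    (fun t _ => (hg t).continuousAt.continuousWithinAt) (fun t _ _ => hg t)]
  simp [sin_circular_end, cos_circular_end]

theorem hasDerivAt_sin_shift (t : ℝ) : HasDerivAt (fun t : ℝ => Real.sin (t + Real.pi / 4))
    (Real.cos (t + Real.pi / 4)) t := by
  simpa using ((hasDerivAt_id t).add_const (Real.pi / 4)).sin

theorem hasDerivAt_cos_shift (t : ℝ) : HasDerivAt (fun t : ℝ => Real.cos (t + Real.pi / 4))
    (-Real.sin (t + Real.pi / 4)) t := by
  simpa using ((hasDerivAt_id t).add_const (Real.pi / 4)).cos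

theorem pathMoment_circularGait :
    pathMoment circularGait circularVelocity (2 * Real.pi) = 0 := by
  rw [pathMoment, integral_circularGait (continuous_pathMomentForm isShapePath_circularGait) 0
    (g := fun x y => x ^ 3 / 3 - y ^ 3 / 3), zero_mul]
  intro t
  refine (((hasDerivAt_id t).const_mul 0).add ((((hasDerivAt_sin_shift t).pow 3).div_const 3).sub
    (((hasDerivAt_cos_shift t).pow 3).div_const 3))).congr_deriv ?_
  simp [pullback, circularGait, circularVelocity]
  ring

theorem moment_circularGait_zero_one :
    moment circularGait circularVelocity (2 * Real.pi) 0 1 = Real.pi := by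
  rw [moment, integral_circularGait (continuous_momentForm isShapePath_circularGait 0 1) (1 / 2)
    (g := fun x y => x * y / 2)]
  · ring
  intro t
  refine (((hasDerivAt_id t).const_mul (1 / 2)).add
    (((hasDerivAt_sin_shift t).mul (hasDerivAt_cos_shift t)).div_const 2)).congr_deriv ?_
  simp [pullback, circularGait, circularVelocity]
  linear_combination (-1 / 2) * Real.sin_sq_add_cos_sq (t + Real.pi / 4)

theorem moment_circularGait_one_two :
    moment circularGait circularVelocity (2 * Real.pi) 1 2 = 0 := by
  rw [moment, integral_circularGait (continuous_momentForm isShapePath_circularGait 1 2) 0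
    (g := fun _ y => -(y ^ 4 / 4)), zero_mul]
  intro t
  refine (((hasDerivAt_id t).const_mul 0).add
    (((hasDerivAt_cos_shift t).pow 4).div_const 4).neg).congr_deriv ?_
  simp [pullback, circularGait, circularVelocity]
  ring

theorem moment_circularGait_two_one :
    moment circularGait circularVelocity (2 * Real.pi) 2 1 = Real.pi / 4 := by
  rw [moment, integral_circularGait (continuous_momentForm isShapePath_circularGait 2 1) (1 / 8)
    (g := fun x y => (x ^ 3 * y - x * y ^ 3) / 8)]
  · ring
  intro t
  have hs := hasDerivAt_sin_shift t
  have hc := hasDerivAt_cos_shift t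
  refine (((hasDerivAt_id t).const_mul (1 / 8)).add
    ((((hs.pow 3).mul hc).sub (hs.mul (hc.pow 3))).div_const 8)).congr_deriv ?_
  simp [pullback, circularGait, circularVelocity]
  have := Real.sin_sq_add_cos_sq (t + Real.pi / 4)
  grind

theorem moment_circularGait_zero_three :
    moment circularGait circularVelocity (2 * Real.pi) 0 3 = 3 * (Real.pi / 4) := by
  rw [moment, integral_circularGait (continuous_momentForm isShapePath_circularGait 0 3) (3 / 8)
    (g := fun x y => (5 * (x * y ^ 3) + 3 * (x ^ 3 * y)) / 8)]
  · ring
  intro t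
  have hs := hasDerivAt_sin_shift t
  have hc := hasDerivAt_cos_shift t
  refine (((hasDerivAt_id t).const_mul (3 / 8)).add
    ((((hs.mul (hc.pow 3)).const_mul 5).add
      (((hs.pow 3).mul hc).const_mul 3)).div_const 8)).congr_deriv ?_
  simp [pullback, circularGait, circularVelocity]
  have := Real.sin_sq_add_cos_sq (t + Real.pi / 4)
  grind

end Circle

section Square

/-- The velocity of the square gait. -/
noncomputable def squareVelocity (t : ℝ) : Fin 2 → ℝ :=
  if t ≤ 2 then ![0, -1]
  else if t ≤ 4 then ![-1, 0]
  else if t ≤ 6 then ![0, 1]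
  else ![1, 0]

theorem isShapePath_squareGait : IsShapePath squareGait squareVelocity {2, 4, 6} where
  continuous := by
    have hc : ∀ f g : ℝ → ℝ, Continuous f → Continuous g → Continuous fun t => ![f t, g t] := by
      intro f g hf hg
      refine continuous_pi fun j => ?_
      fin_cases j <;> simpa
    unfold squareGait
    refine Continuous.if_le (hc _ _ (by fun_prop) (by fun_prop)) (Continuous.if_le
      (hc _ _ (by fun_prop) (by fun_prop)) (Continuous.if_le (hc _ _ (by fun_prop) (by fun_prop))
      (hc _ _ (by fun_prop) (by fun_prop)) continuous_id continuous_const ?_) continuous_id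
      continuous_const ?_) continuous_id continuous_const ?_
    · rintro t rfl
      norm_num
    · rintro t rfl
      norm_num
    · rintro t rfl
      norm_num
  measurable j := by
    have : Measurable squareVelocity :=
      Measurable.ite measurableSet_Iic measurable_const (Measurable.ite measurableSet_Iic
        measurable_const (Measurable.ite measurableSet_Iic measurable_const measurable_const))
    exact (measurable_pi_apply j).comp this
  bounded := by
    refine ⟨1, fun t j => ?_⟩
    unfold squareVelocity
    split_ifs <;> fin_cases j <;> simp
  finite := by simp
  hasDerivAt t ht := by
    have hd : ∀ a b a' b' : ℝ, HasDerivAt (fun t => ![a + a' * t, b + b' * t]) ![a', b'] t := by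
      intro a b a' b'
      refine hasDerivAt_pi.mpr fun j => ?_
      fin_cases j
      · simpa using ((hasDerivAt_id t).const_mul a').const_add a
      · simpa using ((hasDerivAt_id t).const_mul b').const_add b
    simp only [mem_insert_iff, mem_singleton_iff, not_or] at ht
    rcases lt_or_gt_of_ne ht.1 with h2 | h2
    · rw [squareVelocity, if_pos h2.le]
      refine (hd 1 1 0 (-1)).congr_of_eventuallyEq ?_
      filter_upwards [Iio_mem_nhds h2] with x (hx : x < 2)
      simp [squareGait, hx.le, sub_eq_add_neg]
    rcases lt_or_gt_of_ne ht.2.1 with h4 | h4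
    · rw [squareVelocity, if_neg h2.not_ge, if_pos h4.le]
      refine (hd 3 (-1) (-1) 0).congr_of_eventuallyEq ?_
      filter_upwards [Ioo_mem_nhds h2 h4] with x hx
      simp [squareGait, hx.1.not_ge, hx.2.le, sub_eq_add_neg]
    rcases lt_or_gt_of_ne ht.2.2 with h6 | h6
    · rw [squareVelocity, if_neg h2.not_ge, if_neg h4.not_ge, if_pos h6.le]
      refine (hd (-1) (-5) 0 1).congr_of_eventuallyEq ?_
      filter_upwards [Ioo_mem_nhds h4 h6] with x hx
      have : ¬ x ≤ 2 := by linarith [hx.1]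
      simp [squareGait, this, hx.1.not_ge, hx.2.le]
      ring
    · rw [squareVelocity, if_neg h2.not_ge, if_neg h4.not_ge, if_neg h6.not_ge]
      refine (hd (-7) 1 1 0).congr_of_eventuallyEq ?_
      filter_upwards [Ioi_mem_nhds h6] with x (hx : 6 < x)
      have h2' : ¬ x ≤ 2 := by linarith
      have h4' : ¬ x ≤ 4 := by linarith
      simp [squareGait, h2', h4', hx.not_ge]
      ring
  continuousAt t ht := by
    simp only [mem_insert_iff, mem_singleton_iff, not_or] at ht
    rcases lt_or_gt_of_ne ht.1 with h2 | h2
    · refine (continuousAt_const (y := ![0, -1])).congr ?_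
      filter_upwards [Iio_mem_nhds h2] with x (hx : x < 2)
      simp [squareVelocity, hx.le]
    rcases lt_or_gt_of_ne ht.2.1 with h4 | h4
    · refine (continuousAt_const (y := ![-1, 0])).congr ?_
      filter_upwards [Ioo_mem_nhds h2 h4] with x hx
      simp [squareVelocity, hx.1.not_ge, hx.2.le]
    rcases lt_or_gt_of_ne ht.2.2 with h6 | h6
    · refine (continuousAt_const (y := ![0, 1])).congr ?_
      filter_upwards [Ioo_mem_nhds h4 h6] with x hx
      have : ¬ x ≤ 2 := by linarith [hx.1]
      simp [squareVelocity, this, hx.1.not_ge, hx.2.le]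
    · refine (continuousAt_const (y := ![1, 0])).congr ?_
      filter_upwards [Ioi_mem_nhds h6] with x (hx : 6 < x)
      have h2' : ¬ x ≤ 2 := by linarith
      have h4' : ¬ x ≤ 4 := by linarith
      simp [squareVelocity, h2', h4', hx.not_ge]

/-- The integral of a one-form with coefficients `g` along the four sides of the square gait. -/
theorem integral_squareGait {g : (Fin 2 → ℝ) → Fin 2 → ℝ}
    (hg : ∀ j, Continuous fun t => g (squareGait t) j) :
    ∫ t in (0 : ℝ)..8, pullback (fun t => g (squareGait t)) squareVelocity t
      = (((∫ t in (0 : ℝ)..2, -g ![1, 1 - t] 1) + ∫ t in (2 : ℝ)..4, -g ![3 - t, -1] 0)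
        + ∫ t in (4 : ℝ)..6, g ![-1, t - 5] 1) + ∫ t in (6 : ℝ)..8, g ![t - 7, 1] 0 := by
  have hi := fun a b => isShapePath_squareGait.intervalIntegrable_pullback
    (c := fun t => g (squareGait t)) hg a b
  rw [← intervalIntegral.integral_add_adjacent_intervals (hi 0 6) (hi 6 8),
    ← intervalIntegral.integral_add_adjacent_intervals (hi 0 4) (hi 4 6),
    ← intervalIntegral.integral_add_adjacent_intervals (hi 0 2) (hi 2 4)]
  congr 1
  · congr 1
    · congr 1
      · refine intervalIntegral.integral_congr_ae (Eventually.of_forall fun t ht => ?_)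
        rw [uIoc_of_le (by norm_num)] at ht
        simp [pullback, squareGait, squareVelocity, ht.2]
      · refine intervalIntegral.integral_congr_ae (Eventually.of_forall fun t ht => ?_)
        rw [uIoc_of_le (by norm_num)] at ht
        simp [pullback, squareGait, squareVelocity, ht.1.not_ge, ht.2]
    · refine intervalIntegral.integral_congr_ae (Eventually.of_forall fun t ht => ?_)
      rw [uIoc_of_le (by norm_num)] at ht
      have : ¬ t ≤ 2 := by linarith [ht.1]
      simp [pullback, squareGait, squareVelocity, this, ht.1.not_ge, ht.2]
  · refine intervalIntegral.integral_congr_ae (Eventually.of_forall fun t ht => ?_)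
    rw [uIoc_of_le (by norm_num)] at ht
    have h2 : ¬ t ≤ 2 := by linarith [ht.1]
    have h4 : ¬ t ≤ 4 := by linarith [ht.1]
    simp [pullback, squareGait, squareVelocity, h2, h4, ht.1.not_ge]

theorem pathMoment_squareGait : pathMoment squareGait squareVelocity 8 = 0 := by
  have := integral_squareGait (g := fun φ => ![φ 0 * φ 1, -(φ 0 * φ 1)])
    (continuous_pathMomentForm isShapePath_squareGait)
  have e1 : ∫ t in (0 : ℝ)..2, (1 - t) = 0 := by
    rw [intervalIntegral.integral_comp_sub_left (fun x => x) 1]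
    norm_num
  have e3 : ∫ t in (2 : ℝ)..4, (3 - t) = 0 := by
    rw [intervalIntegral.integral_comp_sub_left (fun x => x) 3]
    norm_num
  rw [pathMoment, this]
  norm_num [e1, e3]

theorem moment_squareGait (m n : ℕ) : moment squareGait squareVelocity 8 m n
    = (1 - (-1) ^ n) * ∫ x in (-1 : ℝ)..1, x ^ m := by
  have := integral_squareGait (g := fun φ => ![φ 0 ^ m * φ 1 ^ n, 0])
    (continuous_momentForm isShapePath_squareGait m n)
  rw [moment, this]
  have e2 : ∫ t in (2 : ℝ)..4, (3 - t) ^ m = ∫ x in (-1 : ℝ)..1, x ^ m := by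
    rw [intervalIntegral.integral_comp_sub_left (fun x => x ^ m) 3]
    norm_num
  have e4 : ∫ t in (6 : ℝ)..8, (t - 7) ^ m = ∫ x in (-1 : ℝ)..1, x ^ m := by
    rw [intervalIntegral.integral_comp_sub_right (fun x => x ^ m) 7]
    norm_num
  simp only [Matrix.cons_val_zero, Matrix.cons_val_one, one_pow, mul_one, neg_zero,
    intervalIntegral.integral_zero, zero_add, add_zero, intervalIntegral.integral_neg,
    intervalIntegral.integral_mul_const, e2, e4]
  ring

end Square

/-- Existence of the net displacement for every amplitude and its expansion, in terms of the
moments of the gait. -/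
theorem exists_netDisplacement_expansion {s D : ℝ → Fin 2 → ℝ} {N : Set ℝ} {T ct l η A B : ℝ}
    (hct : 0 < ct) (hl : 0 < l) (hη : 0 < η) (hη1 : η < 1) (h : IsShapePath s D N) (hT : 0 ≤ T)
    (hdiag : s 0 0 = s 0 1) (hclosed : s T = s 0) (hpath : pathMoment s D T = 0)
    (h01 : moment s D T 0 1 = A) (h21 : moment s D T 2 1 = B) (h12 : moment s D T 1 2 = 0)
    (h03 : moment s D T 0 3 = 3 * B) :
    ∃ X : ℝ → ℝ,
      (∀ ε : ℝ, HasNetDisplacement ct ![η * l, (1 - η) / 2 * l, (1 - η) / 2 * l]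
        (fun t => ε • s t) T (X ε)) ∧
      (fun ε : ℝ => X ε - (f2 (A / 16) l η * ε ^ 2 - f4 (B / 256) l η * ε ^ 4))
        =O[𝓝 0] fun ε : ℝ => ε ^ 6 := by
  have hL : ∀ i, 0 < ![η * l, (1 - η) / 2 * l, (1 - η) / 2 * l] i := by
    have : 0 < (1 - η) / 2 := by linarith
    intro i
    fin_cases i <;> simp <;> positivity
  subst h01 h21
  exact ⟨_, fun ε => (h.const_smul ε).hasNetDisplacement hct hL hT,
    isBigO_displacement_of_moments hct hl hη hη1 h hT hdiag hclosed hpath h12 h03⟩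

end PurcellSwimmer

theorem proposition3p1 (ct l₀ l₁ l₂ l η : ℝ) (hct : 0 < ct) (hl₀ : 0 < l₀) (hl₁ : 0 < l₁)
    (hsymm : l₁ = l₂) (hl : l = l₀ + l₁ + l₂) (hη : η = l₀ / l) :
    (∃ X : ℝ → ℝ,
      (∀ ε : ℝ, PurcellSwimmer.HasNetDisplacement ct ![l₀, l₁, l₂]
        (fun t => ε • PurcellSwimmer.squareGait t) 8 (X ε)) ∧
      (fun ε : ℝ => X ε - (PurcellSwimmer.f2 (1 / 4) l η * ε ^ 2
        - PurcellSwimmer.f4 (1 / 192) l η * ε ^ 4)) =O[𝓝 0] fun ε : ℝ => ε ^ 6) ∧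
    (∃ X : ℝ → ℝ,
      (∀ ε : ℝ, PurcellSwimmer.HasNetDisplacement ct ![l₀, l₁, l₂]
        (fun t => ε • PurcellSwimmer.circularGait t) (2 * Real.pi) (X ε)) ∧
      (fun ε : ℝ => X ε - (PurcellSwimmer.f2 (Real.pi / 16) l η * ε ^ 2
        - PurcellSwimmer.f4 (Real.pi / 1024) l η * ε ^ 4)) =O[𝓝 0] fun ε : ℝ => ε ^ 6) := by
  subst hsymm
  have hlpos : 0 < l := by linarith
  have hη0 : 0 < η := hη ▸ div_pos hl₀ hlpos
  have hη1 : η < 1 := by rw [hη, div_lt_one hlpos]; linarith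
  have e0 : l₀ = η * l := by rw [hη]; field_simp
  have e1 : l₁ = (1 - η) / 2 * l := by linarith
  rw [e0, e1]
  constructor
  · have := PurcellSwimmer.exists_netDisplacement_expansion (A := 4) (B := 4 / 3) hct hlpos hη0 hη1
      PurcellSwimmer.isShapePath_squareGait (T := 8) (by norm_num)
      (by norm_num [PurcellSwimmer.squareGait])
      (by norm_num [PurcellSwimmer.squareGait]) PurcellSwimmer.pathMoment_squareGait
      (by rw [PurcellSwimmer.moment_squareGait]; norm_num)
      (by rw [PurcellSwimmer.moment_squareGait]; norm_num [integral_pow])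
      (by rw [PurcellSwimmer.moment_squareGait]; norm_num)
      (by rw [PurcellSwimmer.moment_squareGait]; norm_num)
    norm_num at this ⊢
    exact this
  · have := PurcellSwimmer.exists_netDisplacement_expansion (A := Real.pi) (B := Real.pi / 4) hct
      hlpos hη0 hη1 PurcellSwimmer.isShapePath_circularGait Real.two_pi_pos.le
      (by simp [PurcellSwimmer.circularGait])
      (by simp [PurcellSwimmer.circularGait, PurcellSwimmer.sin_circular_end,
        PurcellSwimmer.cos_circular_end]) PurcellSwimmer.pathMoment_circularGait
      PurcellSwimmer.moment_circularGait_zero_one PurcellSwimmer.moment_circularGait_two_one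
      PurcellSwimmer.moment_circularGait_one_two PurcellSwimmer.moment_circularGait_zero_three
    rwa [div_div, show (4 : ℝ) * 256 = 1024 by norm_num] at this
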